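/- Let $n,j,k\in\mathbb N$ with $1\le j<k$, let $P,Q,R\in(1,\infty]$ and $p,q,r\in[1,\infty]$ satisfy $$\frac1P=\frac{j/k}{R}+\frac{1-j/k}{Q},\qquad \frac1p=\frac{j/k}{r}+\frac{1-j/k}{q}\qquad(1/\infty:=0).$$ Then there is a constant $C<\infty$, depending only on $n,j,k,P,Q,R,p,q,r$, such that $$\|\nabla^j u\|_{P,p}\le C\,\|\nabla^k u\|_{R,r}^{j/k}\,\|u\|_{Q,q}^{1-j/k}$$ for every $k$-times weakly differentiable $u:\mathbb R^n\to\mathbb R$ for which the right-hand side is not of the indeterminate form $0\cdot\infty$ (that is, except when $\nabla^k u=0$ a.e. and $\|u\|_{Q,q}=\infty$). Here $u$ is $k$-times weakly differentiable if $u\in L^1_{\mathrm{loc}}(\mathbb R^n)$ and all its weak partial derivatives of order at most $k$ exist in $L^1_{\mathrm{loc}}(\mathbb R^n)$; $\nabla^m u$ is the tensor of all weak partial derivatives $\partial_{a_1}\cdots\partial_{a_m}u$, $1\le a_1,\dots,a_m\le n$, and $|\nabla^m u|$ is its Euclidean norm. For a measurable scalar- or vector-valued function $f$ on $\mathbb R^n$,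 $f^*(t)=\inf\{s>0:|\{|f|>s\}|\le t\}$ for $t>0$ (with $\inf\emptyset=\infty$, and $|\{|f|>s\}|$ the Lebesgue measure), and for $1\le A,a\le\infty$ $$\|f\|_{A,a}=\bigl\|t^{1/A-1/a}f^*(t)\bigr\|_{L^a(0,\infty)}\in[0,\infty].$$ -/

import Mathlib

open MeasureTheory
open scoped ENNReal NNReal ContDiff

namespace GagliardoNirenberg

/-- `ℝⁿ` with the Euclidean norm and Lebesgue measure. -/
abbrev Eucl (n : ℕ) : Type := EuclideanSpace ℝ (Fin n)

/-- Values of the `m`-th gradient: all partial derivatives `∂_{a 0} ⋯ ∂_{a (m-1)} u`,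
with the Euclidean norm. -/
abbrev Tensor (n m : ℕ) : Type := EuclideanSpace ℝ (Fin m → Fin n)

/-- The classical iterated partial derivative `∂_{a 0} ⋯ ∂_{a (m-1)} φ`. -/
noncomputable def partialDeriv {n m : ℕ} (a : Fin m → Fin n) (φ : Eucl n → ℝ) (x : Eucl n) : ℝ :=
  iteratedFDeriv ℝ m φ x (fun i => EuclideanSpace.single (a i) (1 : ℝ))

/-- `G` is (a representative of) the `m`-th weak gradient `∇ᵐ u` on `ℝⁿ`. -/
structure IsWeakGradient {n : ℕ} (m : ℕ) (u : Eucl n → ℝ) (G : Eucl n → Tensor n m) : Prop where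
  locallyIntegrable : LocallyIntegrable G volume
  integral_eq : ∀ φ : Eucl n → ℝ, ContDiff ℝ ∞ φ → HasCompactSupport φ →
    ∀ a : Fin m → Fin n,
      ∫ x, u x * partialDeriv a φ x = (-1 : ℝ) ^ m * ∫ x, G x a * φ x

/-- `u` is `k`-times weakly differentiable: `u` is locally integrable and has locally integrable
weak derivatives of all orders up to `k`. -/
structure WeaklyDifferentiable {n : ℕ} (k : ℕ) (u : Eucl n → ℝ) : Prop where
  locallyIntegrable : LocallyIntegrable u volume
  exists_gradient : ∀ m ≤ k, ∃ G : Eucl n → Tensor n m, IsWeakGradient m u G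

/-- The non-increasing rearrangement `f*(t) = inf {s : |{|f| > s}| ≤ t}`. The levels `s = 0` and
`s = ∞` are admitted; this does not change the infimum. -/
noncomputable def rearrangement {n : ℕ} {F : Type*} [NormedAddCommGroup F] (f : Eucl n → F)
    (t : ℝ) : ℝ≥0∞ :=
  sInf {s : ℝ≥0∞ | volume {x | s < ‖f x‖ₑ} ≤ ENNReal.ofReal t}

/-- The Lorentz functional `‖f‖_{P,p} = ‖t ^ (1/P - 1/p) f*(t)‖_{Lᵖ(0,∞)}`, with `1/∞ = 0`. -/
noncomputable def lorentzNorm {n : ℕ} {F : Type*} [NormedAddCommGroup F] (f : Eucl n → F)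
    (P p : ℝ≥0∞) : ℝ≥0∞ :=
  eLpNorm (fun t : ℝ => ENNReal.ofReal (t ^ ((1 / P).toReal - (1 / p).toReal)) * rearrangement f t)
    p (volume.restrict (Set.Ioi 0))

end GagliardoNirenberg

open GagliardoNirenberg

namespace GagliardoNirenberg

open Set Filter Topology

/-! ### Minkowski and Hölder inequalities for functions with values in `[0, ∞]`. -/

section LebesgueNorms

variable {α : Type*} [MeasurableSpace α] {μ : Measure α}

/-! The theorem reduces to a pointwise bound. With `M` the Hardy–Littlewood maximal operator and `θ
= j/k`, almost everywhere `|∇ʲu| ≤ C (MM|∇ᵏu|)^θ (MM|u|)^(1-θ)`. Hölder's inequality for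
rearrangements (`lorentz_le_of_ae_le_mul_rpow`) and the boundedness of `M` on Lorentz spaces with
first exponent above one (`exists_lorentz_maximal_le`) then give the norm inequality.

The pointwise bound comes from the additive form `|∇ʲu| ≤ C (ε^(-j) MM|u| + ε^(k-j) MM|∇ᵏu|)`, valid
for every `ε > 0`, by choosing `ε` to balance the two terms (`le_two_mul_rpow_of_forall_scale`).

For smooth `w` a single `M` suffices (`exists_partialDeriv_le_maximal`). Take the forward difference
of order `k-j` of `s ↦ ∂ᵃw(x + sεy)` at `0` and average it in `y` against a bump. The node `s = 0`
contributes `±∂ᵃw(x)`. At the other nodes integration by parts moves all `j` derivatives onto the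
bump, which leaves averages of `w` times `ε^(-j)`. The whole difference is controlled by derivatives
of order `k` along the segment. For weak gradients, mollify: mollified functions are dominated by
maximal functions, whence the second `M`, and they converge at almost every point
(`exists_weakGradient_le_maximal`).

The maximal bound rests on `(Mg)*(t) ≤ K ∑ 2⁻ⁱ g*(2⁻ⁱ⁻¹t)`, obtained by cutting `g` at height
`g*(t)` and applying the weak `(1, 1)` inequality to the upper part. Each dilation costs
`2^((i+1)/P)`, so the sum converges exactly because `P > 1`. -/

lemma eLpNorm_const_mul_ennreal (c : ℝ≥0∞) (hc : c ≠ ⊤) (f : α → ℝ≥0∞) (p : ℝ≥0∞) :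
    eLpNorm (fun x => c * f x) p μ = c * eLpNorm f p μ := by
  rcases eq_or_ne p 0 with rfl | hp0
  · simp
  rcases eq_or_ne p ⊤ with rfl | hp
  · simp only [eLpNorm_exponent_top, eLpNormEssSup, enorm_eq_self]
    exact ENNReal.essSup_const_mul
  · have hp' := ENNReal.toReal_pos hp0 hp
    simp only [eLpNorm_eq_lintegral_rpow_enorm_toReal hp0 hp, enorm_eq_self,
      ENNReal.mul_rpow_of_nonneg _ _ hp'.le]
    rw [lintegral_const_mul' _ _ (ENNReal.rpow_ne_top_of_nonneg hp'.le hc),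
      ENNReal.mul_rpow_of_nonneg _ _ (by positivity), ← ENNReal.rpow_mul,
      mul_one_div_cancel hp'.ne', ENNReal.rpow_one]

/-- Minkowski's inequality for partial sums passes to the limit by monotone convergence; for `p = ∞`
it is a termwise bound. -/
lemma eLpNorm_tsum_le {f : ℕ → α → ℝ≥0∞} (hf : ∀ i, AEMeasurable (f i) μ) {p : ℝ≥0∞}
    (hp : 1 ≤ p) :
    eLpNorm (fun x => ∑' i, f i x) p μ ≤ ∑' i, eLpNorm (f i) p μ := by
  have hp0 : p ≠ 0 := (zero_lt_one.trans_le hp).ne'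
  rcases eq_or_ne p ⊤ with rfl | hpt
  · simp only [eLpNorm_exponent_top, eLpNormEssSup, enorm_eq_self]
    refine essSup_le_of_ae_le _ ?_
    filter_upwards [ae_all_iff.2 fun i => ENNReal.ae_le_essSup (μ := μ) (f i)] with x hx
    exact ENNReal.tsum_le_tsum hx
  have hp' := ENNReal.toReal_pos hp0 hpt
  have hfin (N : ℕ) : eLpNorm (fun x => ∑ i ∈ Finset.range N, f i x) p μ
      ≤ ∑' i, eLpNorm (f i) p μ := by
    have := eLpNorm_sum_le (s := Finset.range N) (f := f) (μ := μ)
      (fun i _ => (hf i).aestronglyMeasurable) hp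
    refine le_trans (le_of_eq ?_) (this.trans (ENNReal.sum_le_tsum _))
    congr 1
    ext x
    simp
  simp only [eLpNorm_eq_lintegral_rpow_enorm_toReal hp0 hpt, enorm_eq_self] at hfin ⊢
  rw [one_div, ENNReal.rpow_inv_le_iff hp']
  have hmono (x : α) : Monotone fun N => ∑ i ∈ Finset.range N, f i x := fun a b hab =>
    Finset.sum_le_sum_of_subset (Finset.range_mono hab)
  have key (x : α) : (∑' i, f i x) ^ p.toReal
      = ⨆ N, (∑ i ∈ Finset.range N, f i x) ^ p.toReal := by
    rw [ENNReal.tsum_eq_iSup_nat]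
    exact (ENNReal.orderIsoRpow _ hp').map_iSup _
  simp_rw [key]
  rw [lintegral_iSup']
  · refine iSup_le fun N => ?_
    have := hfin N
    rwa [one_div, ENNReal.rpow_inv_le_iff hp'] at this
  · intro N
    exact (Finset.aemeasurable_fun_sum _ fun i _ => hf i).pow_const _
  · exact ae_of_all _ fun x a b hab => ENNReal.rpow_le_rpow (hmono x hab) hp'.le

/-- Hölder's inequality for a geometric mean of two functions. -/
lemma eLpNorm_rpow_mul_rpow_le {F G : α → ℝ≥0∞} (hF : AEMeasurable F μ) (hG : AEMeasurable G μ)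
    {θ : ℝ} (h0 : 0 < θ) (h1 : θ < 1) {p q r : ℝ≥0∞} (hp : 1 ≤ p) (hq : 1 ≤ q) (hr : 1 ≤ r)
    (hpqr : (1 / p).toReal = θ * (1 / r).toReal + (1 - θ) * (1 / q).toReal)
    (hFt : eLpNorm F r μ ≠ ⊤) (hGt : eLpNorm G q μ ≠ ⊤) :
    eLpNorm (fun x => F x ^ θ * G x ^ (1 - θ)) p μ
      ≤ eLpNorm F r μ ^ θ * eLpNorm G q μ ^ (1 - θ) := by
  have h1' : 0 < 1 - θ := by linarith
  have pos {s : ℝ≥0∞} (hs : 1 ≤ s) (hst : s ≠ ⊤) : 0 < s.toReal :=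
    ENNReal.toReal_pos (zero_lt_one.trans_le hs).ne' hst
  have sup_le (H : α → ℝ≥0∞) : ∀ᵐ x ∂μ, H x ≤ eLpNorm H ⊤ μ := by
    simpa only [eLpNorm_exponent_top, eLpNormEssSup, enorm_eq_self] using ENNReal.ae_le_essSup H
  have hp0 : p ≠ 0 := (zero_lt_one.trans_le hp).ne'
  have hq0 : q ≠ 0 := (zero_lt_one.trans_le hq).ne'
  have hr0 : r ≠ 0 := (zero_lt_one.trans_le hr).ne'
  simp only [one_div, ENNReal.toReal_inv] at hpqr
  rcases eq_or_ne p ⊤ with rfl | hpt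
  -- When `1/p = 0` both nonnegative summands vanish, which forces `r = q = ∞`.
  · have hrq : r.toReal⁻¹ = 0 ∧ q.toReal⁻¹ = 0 := by
      have a1 : 0 ≤ θ * r.toReal⁻¹ := by positivity
      have a2 : 0 ≤ (1 - θ) * q.toReal⁻¹ := by positivity
      simp only [ENNReal.toReal_top, inv_zero] at hpqr
      have b1 : θ * r.toReal⁻¹ = 0 := by linarith
      have b2 : (1 - θ) * q.toReal⁻¹ = 0 := by linarith
      exact ⟨(mul_eq_zero.1 b1).resolve_left h0.ne', (mul_eq_zero.1 b2).resolve_left h1'.ne'⟩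
    have hrt : r = ⊤ := by
      by_contra h
      exact (inv_pos.2 (pos hr h)).ne' hrq.1
    have hqt : q = ⊤ := by
      by_contra h
      exact (inv_pos.2 (pos hq h)).ne' hrq.2
    subst hrt hqt
    rw [eLpNorm_exponent_top]
    simp only [eLpNormEssSup, enorm_eq_self]
    refine essSup_le_of_ae_le _ ?_
    filter_upwards [sup_le F, sup_le G] with x hx hy
    exact mul_le_mul' (ENNReal.rpow_le_rpow hx h0.le) (ENNReal.rpow_le_rpow hy h1'.le)
  have hp' := pos hp hpt
  have bound {H : α → ℝ≥0∞} {K : ℝ≥0∞}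
      (h : ∀ᵐ x ∂μ, F x ^ θ * G x ^ (1 - θ) ≤ K * H x) :
      eLpNorm (fun x => F x ^ θ * G x ^ (1 - θ)) p μ ≤ eLpNorm (fun x => K * H x) p μ :=
    eLpNorm_mono_enorm_ae (by simpa only [enorm_eq_self] using h)
  have powNorm {H : α → ℝ≥0∞} {s : ℝ≥0∞} {η : ℝ} (hη : 0 < η) (hs : 1 ≤ s) (hst : s ≠ ⊤)
      (hs' : p.toReal⁻¹ = η * s.toReal⁻¹) :
      eLpNorm (fun x => H x ^ η) p μ = eLpNorm H s μ ^ η := by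
    have hs'' := pos hs hst
    have e : η * p.toReal = s.toReal := by
      field_simp at hs'
      linarith
    simp only [eLpNorm_eq_lintegral_rpow_enorm_toReal hp0 hpt,
      eLpNorm_eq_lintegral_rpow_enorm_toReal (zero_lt_one.trans_le hs).ne' hst, enorm_eq_self,
      ← ENNReal.rpow_mul, e]
    congr 1
    rw [one_div, hs', one_div, mul_comm]
  rcases eq_or_ne r ⊤ with rfl | hrt
  · have hqt : q ≠ ⊤ := by
      rintro rfl
      simp only [ENNReal.toReal_top, inv_zero, mul_zero, add_zero] at hpqr
      exact (inv_pos.2 hp').ne' hpqr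
    have hq' : p.toReal⁻¹ = (1 - θ) * q.toReal⁻¹ := by simpa using hpqr
    rw [← powNorm h1' hq hqt hq']
    rw [← eLpNorm_const_mul_ennreal _ (ENNReal.rpow_ne_top_of_nonneg h0.le hFt)]
    refine bound ?_
    filter_upwards [sup_le F] with x hx
    gcongr
  have hr' := pos hr hrt
  rcases eq_or_ne q ⊤ with rfl | hqt
  · have hr'' : p.toReal⁻¹ = θ * r.toReal⁻¹ := by simpa using hpqr
    rw [← powNorm h0 hr hrt hr'']
    rw [mul_comm, ← eLpNorm_const_mul_ennreal _ (ENNReal.rpow_ne_top_of_nonneg h1'.le hGt)]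
    refine bound ?_
    filter_upwards [sup_le G] with x hx
    rw [mul_comm]
    gcongr
  have hq' := pos hq hqt
  -- These weights sum to one, so they are the Hölder weights for `F^r` and `G^q`.
  set a := θ * p.toReal / r.toReal with ha
  set b := (1 - θ) * p.toReal / q.toReal with hb
  have hab : a + b = 1 := by
    have : p.toReal * p.toReal⁻¹ = 1 := mul_inv_cancel₀ hp'.ne'
    rw [hpqr] at this
    rw [ha, hb, div_eq_mul_inv, div_eq_mul_inv]
    linarith
  have key := ENNReal.lintegral_mul_norm_pow_le (μ := μ) (hF.pow_const r.toReal)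
    (hG.pow_const q.toReal) (p := a) (q := b) (by positivity) (by positivity) hab
  simp only [eLpNorm_eq_lintegral_rpow_enorm_toReal hp0 hpt,
    eLpNorm_eq_lintegral_rpow_enorm_toReal hq0 hqt,
    eLpNorm_eq_lintegral_rpow_enorm_toReal hr0 hrt, enorm_eq_self]
  rw [one_div, ENNReal.rpow_inv_le_iff hp']
  simp only [ENNReal.mul_rpow_of_nonneg _ _ hp'.le, ← ENNReal.rpow_mul] at key ⊢
  convert key using 5 <;> first | (rw [ha]; field_simp) | (rw [hb]; field_simp)

end LebesgueNorms

/-! ### Decreasing rearrangements and Lorentz functionals. -/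

section Rearrangement

variable {n : ℕ}

/-- The non-increasing rearrangement of a function with values in `[0, ∞]`. -/
noncomputable def rearr (g : Eucl n → ℝ≥0∞) (t : ℝ) : ℝ≥0∞ :=
  sInf {s : ℝ≥0∞ | volume {x | s < g x} ≤ ENNReal.ofReal t}

/-- The Lorentz functional of a function with values in `[0, ∞]`. -/
noncomputable def lorentz (g : Eucl n → ℝ≥0∞) (P p : ℝ≥0∞) : ℝ≥0∞ :=
  eLpNorm (fun t : ℝ => ENNReal.ofReal (t ^ ((1 / P).toReal - (1 / p).toReal)) * rearr g t)
    p (volume.restrict (Ioi 0))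

lemma lorentzNorm_eq_lorentz {F : Type*} [NormedAddCommGroup F] (f : Eucl n → F) (P p : ℝ≥0∞) :
    lorentzNorm f P p = lorentz (fun x => ‖f x‖ₑ) P p := rfl

/-- The infimum is attained: along levels decreasing to it, the superlevel sets increase and their
measures pass to the limit. -/
lemma volume_rearr_lt_le (g : Eucl n → ℝ≥0∞) (t : ℝ) :
    volume {x | rearr g t < g x} ≤ ENNReal.ofReal t := by
  obtain ⟨s, hs, hlim, hmem⟩ := exists_seq_tendsto_sInf
    (S := {s : ℝ≥0∞ | volume {x | s < g x} ≤ ENNReal.ofReal t}) ⟨⊤, by simp⟩ (OrderBot.bddBelow _)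
  have hsub : {x | rearr g t < g x} ⊆ ⋃ i, {x | s i < g x} := by
    intro x hx
    exact mem_iUnion.2 (hlim.eventually_lt_const hx).exists
  refine (measure_mono hsub).trans ?_
  have hmono : Monotone fun i => {x | s i < g x} := fun a b hab x hx => by
    rw [mem_ofPred_eq] at hx ⊢
    exact (hs hab).trans_lt hx
  rw [hmono.measure_iUnion]
  exact iSup_le hmem

lemma rearr_le_iff {g : Eucl n → ℝ≥0∞} {t : ℝ} {s : ℝ≥0∞} :
    rearr g t ≤ s ↔ volume {x | s < g x} ≤ ENNReal.ofReal t :=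
  ⟨fun h => (measure_mono fun _ hx => h.trans_lt hx).trans (volume_rearr_lt_le g t),
    fun h => sInf_le h⟩

lemma rearr_antitone (g : Eucl n → ℝ≥0∞) : Antitone (rearr g) := fun _ _ hab =>
  rearr_le_iff.2 ((volume_rearr_lt_le g _).trans (ENNReal.ofReal_le_ofReal hab))

lemma measurable_rearr (g : Eucl n → ℝ≥0∞) : Measurable (rearr g) := (rearr_antitone g).measurable

lemma rearr_mono_ae {g h : Eucl n → ℝ≥0∞} (hgh : g ≤ᵐ[volume] h) (t : ℝ) :
    rearr g t ≤ rearr h t := by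
  refine rearr_le_iff.2 ((measure_mono_ae ?_).trans (volume_rearr_lt_le h t))
  filter_upwards [hgh] with x hx hlt
  exact lt_of_lt_of_le hlt hx

/-- Where the product exceeds the bound, one factor exceeds its own rearrangement at `t/2`; each of
these two sets has measure at most `t/2`. -/
lemma rearr_mul_rpow_le (A B : Eucl n → ℝ≥0∞) (c : ℝ≥0∞) {a b : ℝ} (ha : 0 ≤ a) (hb : 0 ≤ b)
    {t : ℝ} (ht : 0 ≤ t) :
    rearr (fun x => c * (A x ^ a * B x ^ b)) t
      ≤ c * (rearr A (2⁻¹ * t) ^ a * rearr B (2⁻¹ * t) ^ b) := by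
  refine rearr_le_iff.2 ?_
  have hsub : {x | c * (rearr A (2⁻¹ * t) ^ a * rearr B (2⁻¹ * t) ^ b) < c * (A x ^ a * B x ^ b)}
      ⊆ {x | rearr A (2⁻¹ * t) < A x} ∪ {x | rearr B (2⁻¹ * t) < B x} := by
    intro x hx
    by_contra hcon
    rw [mem_ofPred_eq] at hx
    simp only [mem_union, mem_ofPred_eq, not_or, not_lt] at hcon
    refine (lt_irrefl _) (lt_of_lt_of_le hx ?_)
    gcongr
    exacts [hcon.1, hcon.2]
  refine (measure_mono hsub).trans ((measure_union_le _ _).trans ?_)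
  refine (add_le_add (volume_rearr_lt_le _ _) (volume_rearr_lt_le _ _)).trans ?_
  rw [← ENNReal.ofReal_add (by positivity) (by positivity)]
  exact ENNReal.ofReal_le_ofReal (by linarith)

lemma eLpNorm_comp_mul_left (f : ℝ → ℝ≥0∞) {c : ℝ} (hc : 0 < c) (p : ℝ≥0∞) :
    eLpNorm (fun t => f (c * t)) p (volume.restrict (Ioi 0))
      = ENNReal.ofReal c⁻¹ ^ (1 / p).toReal * eLpNorm f p (volume.restrict (Ioi 0)) := by
  have hemb : MeasurableEmbedding (fun t : ℝ => c * t) :=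
    (Homeomorph.mulLeft₀ c hc.ne').measurableEmbedding
  have hpre : (fun t : ℝ => c * t) ⁻¹' Ioi 0 = Ioi 0 := by
    ext t
    simp [hc]
  have hmap : Measure.map (fun t : ℝ => c * t) (volume.restrict (Ioi 0))
      = ENNReal.ofReal c⁻¹ • volume.restrict (Ioi 0) := by
    rw [← hpre, ← hemb.restrict_map, hpre, Real.map_volume_mul_left hc.ne',
      abs_of_pos (inv_pos.2 hc), Measure.restrict_smul]
  have := hemb.eLpNorm_map_measure (p := p) (μ := volume.restrict (Ioi 0)) (g := f)
  rw [hmap, eLpNorm_smul_measure_of_ne_zero (by simpa using hc)] at this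
  exact this.symm

/-- For the Lorentz weight `a = 1/P - 1/p` the dilation factor is `c^(-1/P)`, independent of `p`. -/
lemma eLpNorm_weight_comp_mul_left (h : ℝ → ℝ≥0∞) {c : ℝ} (hc : 0 < c) (a : ℝ) (p : ℝ≥0∞) :
    eLpNorm (fun t => ENNReal.ofReal (t ^ a) * h (c * t)) p (volume.restrict (Ioi 0))
      = ENNReal.ofReal (c ^ (-(a + (1 / p).toReal))) *
        eLpNorm (fun t => ENNReal.ofReal (t ^ a) * h t) p (volume.restrict (Ioi 0)) := by
  have h1 : eLpNorm (fun t => ENNReal.ofReal (t ^ a) * h (c * t)) p (volume.restrict (Ioi 0))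
      = eLpNorm (fun t => ENNReal.ofReal (c ^ (-a)) * (ENNReal.ofReal ((c * t) ^ a) * h (c * t))) p
        (volume.restrict (Ioi 0)) := by
    refine eLpNorm_congr_ae ?_
    filter_upwards [self_mem_ae_restrict measurableSet_Ioi] with t ht
    have ht : 0 < t := ht
    rw [← mul_assoc, ← ENNReal.ofReal_mul (by positivity), Real.mul_rpow hc.le ht.le, ← mul_assoc,
      ← Real.rpow_add hc]
    simp
  rw [h1, eLpNorm_const_mul_ennreal _ ENNReal.ofReal_ne_top,
    eLpNorm_comp_mul_left (fun t => ENNReal.ofReal (t ^ a) * h t) hc, ← mul_assoc,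
    ENNReal.ofReal_rpow_of_pos (by positivity), ← ENNReal.ofReal_mul (by positivity),
    Real.inv_rpow hc.le, ← Real.rpow_neg hc.le, ← Real.rpow_add hc]
  congr 4
  ring

lemma measurable_weight_rearr (g : Eucl n → ℝ≥0∞) (a : ℝ) :
    Measurable fun t : ℝ => ENNReal.ofReal (t ^ a) * rearr g t :=
  (by fun_prop : Measurable fun t : ℝ => ENNReal.ofReal (t ^ a)).mul (measurable_rearr g)

/-- Hölder's inequality for geometric means in Lorentz spaces. -/
lemma lorentz_le_of_ae_le_mul_rpow {H A B : Eucl n → ℝ≥0∞} {c : ℝ≥0∞} (hc : c ≠ ⊤) {θ : ℝ}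
    (h0 : 0 < θ) (h1 : θ < 1) {P Q R p q r : ℝ≥0∞} (hp : 1 ≤ p) (hq : 1 ≤ q) (hr : 1 ≤ r)
    (hPQR : (1 / P).toReal = θ * (1 / R).toReal + (1 - θ) * (1 / Q).toReal)
    (hpqr : (1 / p).toReal = θ * (1 / r).toReal + (1 - θ) * (1 / q).toReal)
    (hH : ∀ᵐ x, H x ≤ c * (A x ^ θ * B x ^ (1 - θ)))
    (hA : lorentz A R r ≠ ⊤) (hB : lorentz B Q q ≠ ⊤) :
    lorentz H P p ≤ c * ENNReal.ofReal (2⁻¹ ^ (-(1 / P).toReal)) *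
      (lorentz A R r ^ θ * lorentz B Q q ^ (1 - θ)) := by
  have h1' : 0 < 1 - θ := by linarith
  set a := (1 / P).toReal - (1 / p).toReal with ha
  have step1 : lorentz H P p ≤ eLpNorm (fun t : ℝ => c * (ENNReal.ofReal (t ^ a) *
      (fun s => rearr A s ^ θ * rearr B s ^ (1 - θ)) (2⁻¹ * t))) p (volume.restrict (Ioi 0)) := by
    refine eLpNorm_mono_enorm_ae ?_
    filter_upwards [self_mem_ae_restrict measurableSet_Ioi] with t ht
    simp only [enorm_eq_self]
    rw [mul_left_comm]
    gcongr
    exact (rearr_mono_ae hH t).trans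
      (rearr_mul_rpow_le A B c h0.le h1'.le (le_of_lt ht))
  refine step1.trans ?_
  rw [eLpNorm_const_mul_ennreal _ hc,
    eLpNorm_weight_comp_mul_left (fun s => rearr A s ^ θ * rearr B s ^ (1 - θ)) (by norm_num),
    mul_assoc, ha, sub_add_cancel]
  gcongr
  refine le_trans (le_of_eq ?_) (eLpNorm_rpow_mul_rpow_le (μ := volume.restrict (Ioi 0))
    (measurable_weight_rearr A ((1 / R).toReal - (1 / r).toReal)).aemeasurable
    (measurable_weight_rearr B ((1 / Q).toReal - (1 / q).toReal)).aemeasurable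
    h0 h1 hp hq hr hpqr hA hB)
  refine eLpNorm_congr_ae ?_
  filter_upwards [self_mem_ae_restrict measurableSet_Ioi] with t ht
  have ht : 0 < t := ht
  rw [ENNReal.mul_rpow_of_nonneg _ _ h0.le, ENNReal.mul_rpow_of_nonneg _ _ h1'.le,
    mul_mul_mul_comm, ENNReal.ofReal_rpow_of_pos (by positivity),
    ENNReal.ofReal_rpow_of_pos (by positivity), ← ENNReal.ofReal_mul (by positivity),
    ← Real.rpow_mul ht.le, ← Real.rpow_mul ht.le, ← Real.rpow_add ht, hPQR, hpqr]
  congr 3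
  ring

/-- A discrete form of Hardy's inequality. -/
lemma lorentz_le_of_rearr_le_tsum {g G : Eucl n → ℝ≥0∞} {K : ℝ≥0∞} (hK : K ≠ ⊤) (P : ℝ≥0∞)
    {p : ℝ≥0∞} (hp : 1 ≤ p)
    (h : ∀ t > 0, rearr G t ≤
      K * ∑' i : ℕ, ENNReal.ofReal (2⁻¹ ^ i) * rearr g (2⁻¹ ^ (i + 1) * t)) :
    lorentz G P p ≤ K * (∑' i : ℕ, ENNReal.ofReal (2⁻¹ ^ i) *
      ENNReal.ofReal ((2⁻¹ ^ (i + 1)) ^ (-(1 / P).toReal))) * lorentz g P p := by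
  set a := (1 / P).toReal - (1 / p).toReal with ha
  have step1 : lorentz G P p ≤ eLpNorm (fun t : ℝ => K * ∑' i : ℕ, (ENNReal.ofReal (2⁻¹ ^ i) *
      (ENNReal.ofReal (t ^ a) * rearr g (2⁻¹ ^ (i + 1) * t)))) p (volume.restrict (Ioi 0)) := by
    refine eLpNorm_mono_enorm_ae ?_
    filter_upwards [self_mem_ae_restrict measurableSet_Ioi] with t ht
    simp only [enorm_eq_self]
    refine (mul_le_mul_right (h t ht) _).trans (le_of_eq ?_)
    rw [mul_left_comm, ← ENNReal.tsum_mul_left]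
    congr 2
    ext i
    rw [mul_left_comm]
  refine step1.trans ?_
  rw [eLpNorm_const_mul_ennreal _ hK, mul_assoc]
  gcongr
  refine (eLpNorm_tsum_le (fun i => Measurable.aemeasurable ?_) hp).trans (le_of_eq ?_)
  · refine Measurable.const_mul (Measurable.mul (by fun_prop) ?_) _
    exact (measurable_rearr g).comp (by fun_prop)
  · rw [← ENNReal.tsum_mul_right]
    refine tsum_congr fun i => ?_
    rw [eLpNorm_const_mul_ennreal _ ENNReal.ofReal_ne_top,
      eLpNorm_weight_comp_mul_left (rearr g) (by positivity), ha, sub_add_cancel, mul_assoc]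
    rfl

/-- The series is geometric with ratio `2^(-(1-s))`. It is applied with `s = 1/P`, and this is where
`P > 1` enters. -/
lemma tsum_geometric_weight_ne_top {s : ℝ} (hs : s < 1) :
    ∑' i : ℕ, ENNReal.ofReal (2⁻¹ ^ i) * ENNReal.ofReal ((2⁻¹ ^ (i + 1)) ^ (-s)) ≠ ⊤ := by
  have hterm (i : ℕ) : ENNReal.ofReal (2⁻¹ ^ i) * ENNReal.ofReal ((2⁻¹ ^ (i + 1)) ^ (-s))
      = ENNReal.ofReal ((2⁻¹ : ℝ) ^ (-s)) * ENNReal.ofReal ((2⁻¹ : ℝ) ^ (1 - s)) ^ i := by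
    rw [← ENNReal.ofReal_mul (by positivity), ← ENNReal.ofReal_pow (by positivity),
      ← ENNReal.ofReal_mul (by positivity)]
    congr 1
    have h2 : (0 : ℝ) < 2⁻¹ := by norm_num
    rw [← Real.rpow_natCast, ← Real.rpow_natCast, ← Real.rpow_natCast, ← Real.rpow_mul h2.le,
      ← Real.rpow_mul h2.le, ← Real.rpow_add h2, ← Real.rpow_add h2]
    congr 1
    push_cast
    ring
  simp_rw [hterm]
  rw [ENNReal.tsum_mul_left, ENNReal.tsum_geometric]
  refine ENNReal.mul_ne_top ENNReal.ofReal_ne_top (ENNReal.inv_ne_top.2 ?_)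
  have : ENNReal.ofReal ((2⁻¹ : ℝ) ^ (1 - s)) < 1 := by
    rw [ENNReal.ofReal_lt_one]
    exact Real.rpow_lt_one (by norm_num) (by norm_num) (by linarith)
  exact (tsub_pos_of_lt this).ne'

lemma exists_pos_lt_of_ae_restrict_Ioi {S : ℝ → Prop}
    (h : ∀ᵐ t ∂(volume.restrict (Ioi (0 : ℝ))), S t) {τ : ℝ} (hτ : 0 < τ) :
    ∃ t, 0 < t ∧ t < τ ∧ S t := by
  by_contra hcon
  push Not at hcon
  have h2 : volume (Ioo 0 τ) = 0 := by
    rw [ae_restrict_iff' measurableSet_Ioi] at h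
    refine measure_mono_null (fun t ht => ?_) (ae_iff.1 h)
    exact fun hS => hcon t ht.1 ht.2 (hS ht.1)
  simp [hτ.not_ge] at h2

lemma eq_zero_of_forall_pos_le_ofReal {v : ℝ≥0∞} (h : ∀ τ > 0, ∃ t, t < τ ∧ v ≤ ENNReal.ofReal t) :
    v = 0 := by
  refine le_antisymm (ENNReal.le_of_forall_pos_le_add fun ε hε _ => ?_) bot_le
  obtain ⟨t, ht, hv⟩ := h ε (by exact_mod_cast hε)
  rw [zero_add]
  refine hv.trans ((ENNReal.ofReal_le_ofReal ht.le).trans ?_)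
  simp

/-- A finite functional makes `g*(t)` finite for arbitrarily small `t`, and `{g = ∞}` then has
measure at most `t`. -/
lemma ae_lt_top_of_lorentz_ne_top {g : Eucl n → ℝ≥0∞} {P p : ℝ≥0∞} (hp : 1 ≤ p)
    (h : lorentz g P p ≠ ⊤) : ∀ᵐ x, g x < ⊤ := by
  have hp0 : p ≠ 0 := (zero_lt_one.trans_le hp).ne'
  have hae : ∀ᵐ t ∂(volume.restrict (Ioi (0 : ℝ))),
      ENNReal.ofReal (t ^ ((1 / P).toReal - (1 / p).toReal)) * rearr g t < ⊤ := by
    rcases eq_or_ne p ⊤ with rfl | hpt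
    · have h' : essSup (fun t : ℝ => ENNReal.ofReal
          (t ^ ((1 / P).toReal - (1 / (⊤ : ℝ≥0∞)).toReal)) * rearr g t)
          (volume.restrict (Ioi 0)) ≠ ⊤ := h
      filter_upwards [ENNReal.ae_le_essSup (μ := volume.restrict (Ioi (0 : ℝ))) (fun t : ℝ =>
        ENNReal.ofReal (t ^ ((1 / P).toReal - (1 / (⊤ : ℝ≥0∞)).toReal)) * rearr g t)] with t ht
      exact lt_of_le_of_lt ht h'.lt_top
    · have h' := lintegral_rpow_enorm_lt_top_of_eLpNorm_lt_top hp0 hpt (lt_top_iff_ne_top.2 h)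
      have hm := (measurable_weight_rearr g ((1 / P).toReal - (1 / p).toReal)).pow_const p.toReal
      filter_upwards [ae_lt_top hm h'.ne] with t ht
      by_contra hcon
      rw [not_lt, top_le_iff] at hcon
      rw [hcon, ENNReal.top_rpow_of_pos (ENNReal.toReal_pos hp0 hpt)] at ht
      exact lt_irrefl _ ht
  have hz : volume {x | ¬ g x < ⊤} = 0 := by
    refine eq_zero_of_forall_pos_le_ofReal fun τ hτ => ?_
    obtain ⟨t, ht0, htτ, ht⟩ := exists_pos_lt_of_ae_restrict_Ioi hae hτ
    refine ⟨t, htτ, ?_⟩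
    have hfin : rearr g t < ⊤ := by
      by_contra hcon
      rw [not_lt, top_le_iff] at hcon
      rw [hcon, ENNReal.mul_top] at ht
      · exact lt_irrefl _ ht
      · simpa using Real.rpow_pos_of_pos ht0 _
    refine (measure_mono fun x hx => ?_).trans (volume_rearr_lt_le g t)
    rw [mem_ofPred_eq, not_lt, top_le_iff] at hx
    simpa [hx] using hfin
  exact ae_iff.2 hz

lemma ae_eq_zero_of_lorentz_eq_zero {g : Eucl n → ℝ≥0∞} {P p : ℝ≥0∞} (hp : 1 ≤ p)
    (h : lorentz g P p = 0) : ∀ᵐ x, g x = 0 := by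
  have hp0 : p ≠ 0 := (zero_lt_one.trans_le hp).ne'
  have hae := (eLpNorm_eq_zero_iff (measurable_weight_rearr g _).aestronglyMeasurable hp0).1 h
  have hz : volume {x | ¬ g x = 0} = 0 := by
    refine eq_zero_of_forall_pos_le_ofReal fun τ hτ => ?_
    obtain ⟨t, ht0, htτ, ht⟩ := exists_pos_lt_of_ae_restrict_Ioi hae hτ
    refine ⟨t, htτ, ?_⟩
    have hfin : rearr g t = 0 := by
      rcases mul_eq_zero.1 ht with h' | h'
      · exact absurd h' (by simpa using Real.rpow_pos_of_pos ht0 _)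
      · exact h'
    refine (measure_mono fun x hx => ?_).trans (volume_rearr_lt_le g t)
    rw [mem_ofPred_eq, hfin]
    exact pos_iff_ne_zero.2 hx
  exact ae_iff.2 hz

lemma lorentz_eq_zero_of_ae_eq_zero {g : Eucl n → ℝ≥0∞} (h : ∀ᵐ x, g x = 0) (P p : ℝ≥0∞) :
    lorentz g P p = 0 := by
  have hz (t : ℝ) : rearr g t = 0 := by
    refine le_antisymm (rearr_le_iff.2 ?_) bot_le
    have : volume {x | 0 < g x} = 0 := by simpa [ae_iff, pos_iff_ne_zero] using h
    simp [this]
  simp [lorentz, hz]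

end Rearrangement

open Metric

/-! ### The maximal operator and its boundedness on Lorentz spaces. -/

section MaximalFunction

variable {n : ℕ}

/-- The centred Hardy–Littlewood maximal function over dyadic radii. -/
noncomputable def maximal (g : Eucl n → ℝ≥0∞) (x : Eucl n) : ℝ≥0∞ :=
  ⨆ i : ℤ, (∫⁻ y in closedBall x ((2 : ℝ) ^ i), g y) / volume (closedBall x ((2 : ℝ) ^ i))

lemma volume_closedBall_mul (x : Eucl n) {c r : ℝ} (hc : 0 ≤ c) (hr : 0 ≤ r) :
    volume (closedBall x (c * r)) = ENNReal.ofReal (c ^ n) * volume (closedBall x r) := by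
  rw [Measure.addHaar_closedBall_mul _ _ hc hr, ← Measure.addHaar_closedBall_center volume x]
  simp

lemma volume_closedBall_ne_zero (x : Eucl n) {r : ℝ} (hr : 0 < r) :
    volume (closedBall x r) ≠ 0 := (measure_closedBall_pos _ _ hr).ne'

lemma volume_closedBall_ne_top (x : Eucl n) (r : ℝ) : volume (closedBall x r) ≠ ⊤ :=
  measure_closedBall_lt_top.ne

/-- Rounding the radius up to a power of two at most doubles it, hence the factor `2ⁿ`. -/
lemma setLIntegral_closedBall_le_maximal (g : Eucl n → ℝ≥0∞) (x : Eucl n) {r : ℝ} (hr : 0 < r) :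
    ∫⁻ y in closedBall x r, g y
      ≤ ENNReal.ofReal (2 ^ n) * volume (closedBall x r) * maximal g x := by
  obtain ⟨i, hi1, hi2⟩ := exists_mem_Ioc_zpow hr (one_lt_two)
  have h2 : (0 : ℝ) < 2 ^ (i + 1) := by positivity
  calc ∫⁻ y in closedBall x r, g y
      ≤ ∫⁻ y in closedBall x ((2 : ℝ) ^ (i + 1)), g y :=
        lintegral_mono_set (closedBall_subset_closedBall hi2)
    _ = volume (closedBall x ((2 : ℝ) ^ (i + 1))) *
        ((∫⁻ y in closedBall x ((2 : ℝ) ^ (i + 1)), g y) /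
          volume (closedBall x ((2 : ℝ) ^ (i + 1)))) :=
        (ENNReal.mul_div_cancel (volume_closedBall_ne_zero x h2)
          (volume_closedBall_ne_top x _)).symm
    _ ≤ ENNReal.ofReal (2 ^ n) * volume (closedBall x r) * maximal g x := by
        gcongr
        · rw [← volume_closedBall_mul x zero_le_two hr.le]
          refine measure_mono (closedBall_subset_closedBall ?_)
          rw [zpow_add_one₀ two_ne_zero]
          linarith
        · exact le_iSup (fun i : ℤ => (∫⁻ y in closedBall x ((2 : ℝ) ^ i), g y) /
            volume (closedBall x ((2 : ℝ) ^ i))) (i + 1)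

lemma maximal_mono_ae {g h : Eucl n → ℝ≥0∞} (hgh : g ≤ᵐ[volume] h) (x : Eucl n) :
    maximal g x ≤ maximal h x :=
  iSup_mono fun _ => ENNReal.div_le_div_right (lintegral_mono_ae (ae_restrict_of_ae hgh)) _

lemma maximal_congr_ae {g h : Eucl n → ℝ≥0∞} (hgh : g =ᵐ[volume] h) : maximal g = maximal h :=
  funext fun x => le_antisymm (maximal_mono_ae hgh.le x) (maximal_mono_ae hgh.symm.le x)

lemma maximal_const_mul {c : ℝ≥0∞} (hc : c ≠ ⊤) (g : Eucl n → ℝ≥0∞) (x : Eucl n) :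
    maximal (fun y => c * g y) x = c * maximal g x := by
  simp only [maximal, lintegral_const_mul' _ _ hc, ENNReal.mul_iSup, mul_div_assoc]

lemma measurable_maximal {g : Eucl n → ℝ≥0∞} (hg : AEMeasurable g volume) :
    Measurable (maximal g) := by
  obtain ⟨g', hg', hgg'⟩ := hg
  rw [maximal_congr_ae hgg']
  refine Measurable.iSup fun i => ?_
  have h1 (x : Eucl n) : volume (closedBall x ((2 : ℝ) ^ i))
      = volume (closedBall (0 : Eucl n) ((2 : ℝ) ^ i)) := Measure.addHaar_closedBall_center _ _ _
  simp_rw [h1]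
  refine Measurable.div_const ?_ _
  have h2 (x : Eucl n) : ∫⁻ y in closedBall x ((2 : ℝ) ^ i), g' y
      = ∫⁻ y, {z : Eucl n × Eucl n | dist z.2 z.1 ≤ (2 : ℝ) ^ i}.indicator
        (fun z => g' z.2) (x, y) := by
    rw [← lintegral_indicator measurableSet_closedBall]
    rfl
  simp_rw [h2]
  refine Measurable.lintegral_prod_right' (Measurable.indicator (by fun_prop) ?_)
  exact measurableSet_le (by fun_prop) measurable_const

/-- The weak-type `(1, 1)` inequality. -/
lemma mul_volume_lt_maximal_le (g : Eucl n → ℝ≥0∞) (s : ℝ≥0∞) :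
    s * volume {x | s < maximal g x} ≤ ENNReal.ofReal (4 ^ n) * ∫⁻ y, g y := by
  -- Capping the radii at `2^N` makes Vitali's covering lemma applicable; the cap is removed at the
  -- end by monotonicity in `N`.
  let U : ℕ → Set (Eucl n) := fun N => {x | ∃ i : ℤ, i ≤ N ∧
    s * volume (closedBall x ((2 : ℝ) ^ i)) < ∫⁻ y in closedBall x ((2 : ℝ) ^ i), g y}
  have hU : {x | s < maximal g x} ⊆ ⋃ N, U N := by
    intro x hx
    rw [mem_ofPred_eq, maximal] at hx
    obtain ⟨i, hi⟩ := lt_iSup_iff.1 hx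
    refine mem_iUnion.2 ⟨i.toNat, i, Int.self_le_toNat i, ?_⟩
    exact (ENNReal.lt_div_iff_mul_lt (Or.inl (volume_closedBall_ne_zero x (by positivity)))
      (Or.inl (volume_closedBall_ne_top x _))).1 hi
  have hmono : Monotone U := by
    rintro a b hab x ⟨i, hi, hx⟩
    exact ⟨i, hi.trans (by exact_mod_cast hab), hx⟩
  have hUN (N : ℕ) : s * volume (U N) ≤ ENNReal.ofReal (4 ^ n) * ∫⁻ y, g y := by
    have hchoice : ∀ x : Eucl n, ∃ i : ℤ, x ∈ U N → i ≤ N ∧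
        s * volume (closedBall x ((2 : ℝ) ^ i)) < ∫⁻ y in closedBall x ((2 : ℝ) ^ i), g y := by
      intro x
      by_cases hx : x ∈ U N
      · obtain ⟨i, hi⟩ := hx
        exact ⟨i, fun _ => hi⟩
      · exact ⟨0, fun h => absurd h hx⟩
    choose i hi using hchoice
    -- The enlargement factor must exceed 3; the choice 4 produces the constant `4ⁿ`.
    obtain ⟨u, hut, hdisj, hcov⟩ := Vitali.exists_disjoint_subfamily_covering_enlargement_closedBall
      (U N) (fun x => x) (fun x => (2 : ℝ) ^ i x) ((2 : ℝ) ^ (N : ℤ))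
      (fun x hx => zpow_le_zpow_right₀ one_le_two (hi x hx).1) 4 (by norm_num)
    have hcount : u.Countable := by
      refine hdisj.countable_of_nonempty_interior fun x _ => ?_
      exact ⟨x, ball_subset_interior_closedBall (mem_ball_self (by positivity))⟩
    have hsub : U N ⊆ ⋃ b ∈ u, closedBall b (4 * (2 : ℝ) ^ i b) := by
      intro x hx
      obtain ⟨b, hb, hxb⟩ := hcov x hx
      exact mem_biUnion hb (hxb (mem_closedBall_self (by positivity)))
    calc s * volume (U N)
        ≤ s * ∑' b : u, volume (closedBall (b : Eucl n) (4 * (2 : ℝ) ^ i b)) := by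
          gcongr
          exact (measure_mono hsub).trans (measure_biUnion_le _ hcount _)
      _ = ENNReal.ofReal (4 ^ n) *
          ∑' b : u, s * volume (closedBall (b : Eucl n) ((2 : ℝ) ^ i b)) := by
          rw [← ENNReal.tsum_mul_left, ← ENNReal.tsum_mul_left]
          refine tsum_congr fun b => ?_
          rw [volume_closedBall_mul _ (by norm_num) (by positivity), mul_left_comm]
      _ ≤ ENNReal.ofReal (4 ^ n) *
          ∑' b : u, ∫⁻ y in closedBall (b : Eucl n) ((2 : ℝ) ^ i b), g y := by
          gcongr with b
          exact (hi b (hut b.2)).2.le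
      _ = ENNReal.ofReal (4 ^ n) * ∫⁻ y in ⋃ b ∈ u, closedBall b ((2 : ℝ) ^ i b), g y := by
          rw [lintegral_biUnion hcount (fun _ _ => measurableSet_closedBall) hdisj]
      _ ≤ ENNReal.ofReal (4 ^ n) * ∫⁻ y, g y := by
          gcongr
          exact Measure.restrict_le_self
  calc s * volume {x | s < maximal g x} ≤ s * volume (⋃ N, U N) := by gcongr
    _ = ⨆ N, s * volume (U N) := by rw [hmono.measure_iUnion, ENNReal.mul_iSup]
    _ ≤ _ := iSup_le hUN

/-- Slice by the levels `g*(2⁻ⁱt)`: the set above level `i` has measure at most `2⁻ⁱt`, and within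
slice `i` the function is at most the next level. Points above every level form a null set. -/
lemma setLIntegral_rearr_lt_le {g : Eucl n → ℝ≥0∞} (hg : Measurable g) {t : ℝ} (ht : 0 < t) :
    ∫⁻ x in {x | rearr g t < g x}, g x
      ≤ ∑' i : ℕ, rearr g (2⁻¹ ^ (i + 1) * t) * ENNReal.ofReal (2⁻¹ ^ i * t) := by
  let l : ℕ → ℝ≥0∞ := fun i => rearr g (2⁻¹ ^ i * t)
  let A : ℕ → Set (Eucl n) := fun i => {x | l i < g x ∧ g x ≤ l (i + 1)}
  have hl0 : l 0 = rearr g t := by simp [l]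
  have hvol (i : ℕ) : volume {x | l i < g x} ≤ ENNReal.ofReal (2⁻¹ ^ i * t) :=
    volume_rearr_lt_le g _
  have hnull : volume {x | ∀ i, l i < g x} = 0 := by
    refine eq_zero_of_forall_pos_le_ofReal fun τ hτ => ?_
    obtain ⟨i, hi⟩ := exists_pow_lt_of_lt_one (div_pos hτ ht) (by norm_num : (2⁻¹ : ℝ) < 1)
    refine ⟨2⁻¹ ^ i * t, (lt_div_iff₀ ht).1 hi, (measure_mono ?_).trans (hvol i)⟩
    exact fun x hx => hx i
  have hsub : {x | rearr g t < g x} ⊆ {x | ∀ i, l i < g x} ∪ ⋃ i, A i := by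
    intro x hx
    by_cases h : ∀ i, l i < g x
    · exact Or.inl h
    · right
      push Not at h
      classical
      have hfind := Nat.find_spec h
      obtain ⟨m, hm⟩ : ∃ m, Nat.find h = m + 1 := by
        refine Nat.exists_eq_succ_of_ne_zero fun h0 => ?_
        rw [h0, hl0] at hfind
        exact absurd hx (not_lt.2 hfind)
      refine mem_iUnion.2 ⟨m, ?_, hm ▸ hfind⟩
      exact not_le.1 (Nat.find_min h (by omega))
  calc ∫⁻ x in {x | rearr g t < g x}, g x
      ≤ ∫⁻ x in {x | ∀ i, l i < g x} ∪ ⋃ i, A i, g x := lintegral_mono_set hsub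
    _ ≤ (∫⁻ x in {x | ∀ i, l i < g x}, g x) + ∫⁻ x in ⋃ i, A i, g x := lintegral_union_le _ _ _
    _ = ∫⁻ x in ⋃ i, A i, g x := by rw [setLIntegral_measure_zero _ _ hnull, zero_add]
    _ ≤ ∑' i, ∫⁻ x in A i, g x := lintegral_iUnion_le _ _
    _ ≤ ∑' i : ℕ, rearr g (2⁻¹ ^ (i + 1) * t) * ENNReal.ofReal (2⁻¹ ^ i * t) := by
        refine ENNReal.tsum_le_tsum fun i => ?_
        have hA : MeasurableSet (A i) :=
          (measurableSet_lt measurable_const hg).inter (measurableSet_le hg measurable_const)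
        calc ∫⁻ x in A i, g x ≤ ∫⁻ _ in A i, l (i + 1) := setLIntegral_mono' hA fun x hx => hx.2
          _ = l (i + 1) * volume (A i) := setLIntegral_const _ _
          _ ≤ _ := by
            gcongr
            exact (measure_mono fun x hx => hx.1).trans (hvol i)

lemma rearr_maximal_le {g : Eucl n → ℝ≥0∞} (hg : AEMeasurable g volume) {t : ℝ} (ht : 0 < t) :
    rearr (maximal g) t ≤ (1 + ENNReal.ofReal (4 ^ n)) *
      ∑' i : ℕ, ENNReal.ofReal (2⁻¹ ^ i) * rearr g (2⁻¹ ^ (i + 1) * t) := by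
  wlog hm : Measurable g generalizing g
  · obtain ⟨g', hg', hgg'⟩ := hg
    have e : rearr g = rearr g' := funext fun t =>
      le_antisymm (rearr_mono_ae hgg'.le t) (rearr_mono_ae hgg'.symm.le t)
    rw [maximal_congr_ae hgg', e]
    exact this hg'.aemeasurable hg'
  set S := ∑' i : ℕ, ENNReal.ofReal (2⁻¹ ^ i) * rearr g (2⁻¹ ^ (i + 1) * t) with hS
  have ht' : ENNReal.ofReal t ≠ 0 := by simpa using ht
  let h : Eucl n → ℝ≥0∞ := {x | rearr g t < g x}.indicator g
  have hset : MeasurableSet {x | rearr g t < g x} := measurableSet_lt measurable_const hm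
  have hint : ∫⁻ x, h x ≤ ENNReal.ofReal t * S := by
    rw [lintegral_indicator hset]
    refine (setLIntegral_rearr_lt_le hm ht).trans (le_of_eq ?_)
    rw [hS, ← ENNReal.tsum_mul_left]
    refine tsum_congr fun i => ?_
    rw [ENNReal.ofReal_mul (by positivity)]
    ring
  -- Since `g ≤ g*(t) + h` and averages preserve constants, only the integrable upper part `h` needs
  -- the weak-type bound.
  have hle (x : Eucl n) : maximal g x ≤ rearr g t + maximal h x := by
    refine iSup_le fun i => ?_
    have hb := volume_closedBall_ne_zero x (by positivity : (0 : ℝ) < 2 ^ i)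
    have hb' := volume_closedBall_ne_top x ((2 : ℝ) ^ i)
    calc (∫⁻ y in closedBall x ((2 : ℝ) ^ i), g y) / volume (closedBall x ((2 : ℝ) ^ i))
        ≤ (∫⁻ y in closedBall x ((2 : ℝ) ^ i), (rearr g t + h y)) /
            volume (closedBall x ((2 : ℝ) ^ i)) := by
          gcongr with y
          by_cases hy : rearr g t < g y
          · rw [show h y = g y from indicator_of_mem (s := {x | rearr g t < g x}) hy g]
            exact le_add_self
          · exact (not_lt.1 hy).trans le_self_add
      _ = rearr g t + (∫⁻ y in closedBall x ((2 : ℝ) ^ i), h y) /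
            volume (closedBall x ((2 : ℝ) ^ i)) := by
          rw [lintegral_add_left measurable_const, setLIntegral_const, ENNReal.add_div,
            ENNReal.mul_div_cancel_right hb hb']
      _ ≤ rearr g t + maximal h x := by
          gcongr
          exact le_iSup (fun i : ℤ => (∫⁻ y in closedBall x ((2 : ℝ) ^ i), h y) /
            volume (closedBall x ((2 : ℝ) ^ i))) i
  have hfirst : rearr g t ≤ S := by
    refine le_trans ?_ (ENNReal.le_tsum 0)
    simp only [pow_zero, ENNReal.ofReal_one, one_mul]
    refine rearr_antitone g ?_
    norm_num
    linarith
  have hmain : rearr (maximal g) t ≤ rearr g t + ENNReal.ofReal (4 ^ n) * S := by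
    rcases eq_or_ne S ⊤ with hST | hST
    · rw [hST, ENNReal.mul_top (by simp)]
      simp
    rw [rearr_le_iff]
    have hsub : {x | rearr g t + ENNReal.ofReal (4 ^ n) * S < maximal g x}
        ⊆ {x | ENNReal.ofReal (4 ^ n) * S < maximal h x} := by
      intro x hx
      exact lt_of_add_lt_add_left (lt_of_lt_of_le hx (hle x))
    refine (measure_mono hsub).trans ?_
    have hweak := mul_volume_lt_maximal_le h (ENNReal.ofReal (4 ^ n) * S)
    -- The weak-type inequality gives no information at level zero; there `h` has integral zero and
    -- its maximal function vanishes.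
    rcases eq_or_ne S 0 with hS0 | hS0
    · have hz : ∫⁻ x, h x = 0 := by simpa [hS0] using hint
      have hzero (x : Eucl n) : maximal h x = 0 := by
        refine le_antisymm (iSup_le fun i => ?_) bot_le
        have : ∫⁻ y in closedBall x ((2 : ℝ) ^ i), h y = 0 :=
          le_antisymm ((lintegral_mono' Measure.restrict_le_self le_rfl).trans hz.le) bot_le
        simp [this]
      simp [hzero]
    · have hc0 : ENNReal.ofReal (4 ^ n) * S ≠ 0 := mul_ne_zero (by simp) hS0
      have hct : ENNReal.ofReal (4 ^ n) * S ≠ ⊤ := ENNReal.mul_ne_top ENNReal.ofReal_ne_top hST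
      refine (ENNReal.mul_le_mul_iff_right hc0 hct).1 (hweak.trans ?_)
      rw [mul_assoc, mul_comm S]
      gcongr
  refine hmain.trans ?_
  rw [add_mul, one_mul]
  gcongr

/-- The maximal operator is bounded on Lorentz spaces with first exponent greater than one. -/
lemma exists_lorentz_maximal_le (n : ℕ) {P p : ℝ≥0∞} (hP : 1 < P) (hp : 1 ≤ p) :
    ∃ C : ℝ≥0∞, C ≠ ⊤ ∧ ∀ g : Eucl n → ℝ≥0∞, AEMeasurable g volume →
      lorentz (maximal g) P p ≤ C * lorentz g P p := by
  have hs : (1 / P).toReal < 1 := by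
    rw [one_div, ← ENNReal.toReal_one]
    exact (ENNReal.toReal_lt_toReal (ENNReal.inv_ne_top.2 (zero_lt_one.trans hP).ne')
      ENNReal.one_ne_top).2 (ENNReal.inv_lt_one.2 hP)
  have hK : (1 + ENNReal.ofReal (4 ^ n)) ≠ ⊤ := by simp
  exact ⟨_, ENNReal.mul_ne_top hK (tsum_geometric_weight_ne_top hs), fun g hg =>
    lorentz_le_of_rearr_le_tsum hK P hp fun t ht => rearr_maximal_le hg ht⟩

lemma exists_lorentz_maximal_maximal_le (n : ℕ) {P p : ℝ≥0∞} (hP : 1 < P) (hp : 1 ≤ p) :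
    ∃ C : ℝ≥0∞, C ≠ ⊤ ∧ ∀ g : Eucl n → ℝ≥0∞, AEMeasurable g volume →
      lorentz (maximal (maximal g)) P p ≤ C * lorentz g P p := by
  obtain ⟨C, hC, h⟩ := exists_lorentz_maximal_le n hP hp
  refine ⟨C * C, ENNReal.mul_ne_top hC hC, fun g hg => ?_⟩
  refine (h _ (measurable_maximal hg).aemeasurable).trans ?_
  rw [mul_assoc]
  gcongr
  exact h g hg

end MaximalFunction

/-! ### Calculus of iterated partial derivatives. -/

section SmoothFunctions

variable {n : ℕ}

lemma differentiable_iteratedFDeriv_apply {φ : Eucl n → ℝ} (hφ : ContDiff ℝ ∞ φ) {m : ℕ}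
    (v : Fin m → Eucl n) : Differentiable ℝ fun x => iteratedFDeriv ℝ m φ x v := by
  have h : Differentiable ℝ (iteratedFDeriv ℝ m φ) :=
    hφ.differentiable_iteratedFDeriv (by exact_mod_cast WithTop.coe_lt_top _)
  exact fun x => (h x).continuousMultilinear_apply_const v

lemma iteratedFDeriv_cons_apply {φ : Eucl n → ℝ} (hφ : ContDiff ℝ ∞ φ) {m : ℕ} (e : Eucl n)
    (v : Fin m → Eucl n) (x : Eucl n) :
    iteratedFDeriv ℝ (m + 1) φ x (Fin.cons e v : Fin (m + 1) → Eucl n)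
      = fderiv ℝ (fun y => iteratedFDeriv ℝ m φ y v) x e := by
  have h : Differentiable ℝ (iteratedFDeriv ℝ m φ) :=
    hφ.differentiable_iteratedFDeriv (by exact_mod_cast WithTop.coe_lt_top _)
  rw [(h x).iteratedFDeriv_succ_apply_left']
  simp

lemma contDiff_partialDeriv {φ : Eucl n → ℝ} (hφ : ContDiff ℝ ∞ φ) {m : ℕ}
    (a : Fin m → Fin n) : ContDiff ℝ ∞ (partialDeriv a φ) := by
  have h : ContDiff ℝ ∞ (iteratedFDeriv ℝ m φ) := hφ.iteratedFDeriv_right (by exact_mod_cast le_top)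
  exact (ContinuousMultilinearMap.apply ℝ (fun _ : Fin m => Eucl n) ℝ
    (fun i => EuclideanSpace.single (a i) (1 : ℝ))).contDiff.comp h

lemma hasCompactSupport_partialDeriv {φ : Eucl n → ℝ} (hφ : HasCompactSupport φ) {m : ℕ}
    (a : Fin m → Fin n) : HasCompactSupport (partialDeriv a φ) :=
  (hφ.iteratedFDeriv m (𝕜 := ℝ)).comp_left
    (g := fun L : ContinuousMultilinearMap ℝ (fun _ : Fin m => Eucl n) ℝ =>
      L fun i => EuclideanSpace.single (a i) (1 : ℝ)) rfl

lemma partialDeriv_zero (a : Fin 0 → Fin n) (φ : Eucl n → ℝ) : partialDeriv a φ = φ := by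
  ext x
  simp [partialDeriv]

lemma partialDeriv_succ {φ : Eucl n → ℝ} (hφ : ContDiff ℝ ∞ φ) {m : ℕ} (a : Fin (m + 1) → Fin n)
    (x : Eucl n) : partialDeriv a φ x =
      fderiv ℝ (partialDeriv (Fin.tail a) φ) x (EuclideanSpace.single (a 0) 1) := by
  unfold partialDeriv
  rw [← iteratedFDeriv_cons_apply hφ]
  congr 1
  ext1 i
  refine Fin.cases ?_ (fun i => ?_) i <;> simp [Fin.tail]

lemma contDiff_fderiv_apply_const {φ : Eucl n → ℝ} (hφ : ContDiff ℝ ∞ φ) (v : Eucl n) :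
    ContDiff ℝ ∞ fun x => fderiv ℝ φ x v :=
  (hφ.fderiv_right (m := ∞) (by simp)).clm_apply contDiff_const

lemma fderiv_fderiv_comm {φ : Eucl n → ℝ} (hφ : ContDiff ℝ ∞ φ) (v w x : Eucl n) :
    fderiv ℝ (fun y => fderiv ℝ φ y v) x w = fderiv ℝ (fun y => fderiv ℝ φ y w) x v := by
  have hd : DifferentiableAt ℝ (fderiv ℝ φ) x :=
    ((hφ.fderiv_right (m := ∞) (by simp)).differentiable (by simp)) x
  have hsymm : IsSymmSndFDerivAt ℝ φ x :=
    hφ.contDiffAt.isSymmSndFDerivAt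
      (by simpa using WithTop.coe_le_coe.2 (le_top : (2 : ℕ∞) ≤ ⊤))
  rw [fderiv_clm_apply hd (differentiableAt_const v), fderiv_clm_apply hd (differentiableAt_const w)]
  simpa using hsymm.eq w v

lemma partialDeriv_fderiv_comm {φ : Eucl n → ℝ} (hφ : ContDiff ℝ ∞ φ) (v : Eucl n) {m : ℕ}
    (a : Fin m → Fin n) : partialDeriv a (fun x => fderiv ℝ φ x v)
      = fun x => fderiv ℝ (partialDeriv a φ) x v := by
  induction m with
  | zero => simp only [partialDeriv_zero]
  | succ m ih =>
    ext x
    rw [partialDeriv_succ (contDiff_fderiv_apply_const hφ v), ih,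
      fderiv_fderiv_comm (contDiff_partialDeriv hφ _)]
    congr 2
    ext y
    rw [partialDeriv_succ hφ]

/-- Each induction step moves the outermost derivative onto `w`, where it becomes the innermost one.
Commutation of derivatives restores the order, so `w` must vary in the induction. -/
lemma integral_mul_partialDeriv {w φ : Eucl n → ℝ} (hw : ContDiff ℝ ∞ w) (hφ : ContDiff ℝ ∞ φ)
    (hc : HasCompactSupport φ) {m : ℕ} (a : Fin m → Fin n) :
    ∫ x, w x * partialDeriv a φ x = (-1 : ℝ) ^ m * ∫ x, partialDeriv a w x * φ x := by
  induction m generalizing w with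
  | zero => simp [partialDeriv_zero]
  | succ m ih =>
    set e : Eucl n := EuclideanSpace.single (a 0) 1
    set ψ := partialDeriv (Fin.tail a) φ with hψ
    have hψs : ContDiff ℝ ∞ ψ := contDiff_partialDeriv hφ _
    have hψc : HasCompactSupport ψ := hasCompactSupport_partialDeriv hc _
    have hwe := contDiff_fderiv_apply_const hw e
    have hψe := contDiff_fderiv_apply_const hψs e
    have hψec : HasCompactSupport fun x => fderiv ℝ ψ x e := hψc.fderiv_apply ℝ e
    have h1 : ∫ x, w x * fderiv ℝ ψ x e = - ∫ x, fderiv ℝ w x e * ψ x :=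
      integral_mul_fderiv_eq_neg_fderiv_mul_of_integrable
        ((hwe.continuous.mul hψs.continuous).integrable_of_hasCompactSupport hψc.mul_left)
        ((hw.continuous.mul hψe.continuous).integrable_of_hasCompactSupport hψec.mul_left)
        ((hw.continuous.mul hψs.continuous).integrable_of_hasCompactSupport hψc.mul_left)
        (fun x _ => (hw.differentiable (by simp)) x) (fun x _ => (hψs.differentiable (by simp)) x)
    simp_rw [partialDeriv_succ hφ]
    rw [h1, ih hwe, partialDeriv_fderiv_comm hw, pow_succ]
    simp_rw [partialDeriv_succ hw]
    ring

lemma partialDeriv_comp_affine {φ : Eucl n → ℝ} (hφ : ContDiff ℝ ∞ φ) {m : ℕ}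
    (a : Fin m → Fin n) (x : Eucl n) (c : ℝ) (y : Eucl n) :
    partialDeriv a (fun z => φ (x + c • z)) y = c ^ m * partialDeriv a φ (x + c • y) := by
  have hx : ContDiff ℝ ∞ fun z => φ (x + z) := hφ.comp (contDiff_const.add contDiff_id)
  unfold partialDeriv
  rw [iteratedFDeriv_comp_const_smul (f := fun z => φ (x + z)) c
    (hx.of_le (by exact_mod_cast le_top))]
  simp [iteratedFDeriv_comp_add_left]

/-- The classical gradient of order `m`, as a tensor field. -/
noncomputable def classicalGradient (m : ℕ) (w : Eucl n → ℝ) (x : Eucl n) : Tensor n m :=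
  WithLp.toLp 2 fun b => partialDeriv b w x

lemma continuous_classicalGradient {w : Eucl n → ℝ} (hw : ContDiff ℝ ∞ w) (m : ℕ) :
    Continuous (classicalGradient m w) :=
  (PiLp.continuous_toLp 2 _).comp
    (continuous_pi fun b => (contDiff_partialDeriv hw b).continuous)

/-- Expand every `v i` in the standard basis; multilinearity leaves one term per index tuple. -/
lemma abs_iteratedFDeriv_apply_le (w : Eucl n → ℝ) {m : ℕ} (z : Eucl n) (v : Fin m → Eucl n) :
    |iteratedFDeriv ℝ m w z v|
      ≤ Fintype.card (Fin m → Fin n) * ((∏ i, ‖v i‖) * ‖classicalGradient m w z‖) := by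
  have hv (i : Fin m) : v i = ∑ l, v i l • EuclideanSpace.single l (1 : ℝ) := by
    simpa using ((EuclideanSpace.basisFun (Fin n) ℝ).sum_repr (v i)).symm
  have hexp : iteratedFDeriv ℝ m w z v
      = ∑ b : Fin m → Fin n, (∏ i, v i (b i)) * partialDeriv b w z := by
    conv_lhs => rw [show v = fun i => ∑ l, v i l • EuclideanSpace.single l (1 : ℝ) from funext hv]
    rw [ContinuousMultilinearMap.map_sum]
    refine Finset.sum_congr rfl fun b _ => ?_
    rw [ContinuousMultilinearMap.map_smul_univ]
    rfl
  rw [hexp]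
  refine (Finset.abs_sum_le_sum_abs _ _).trans ?_
  rw [← nsmul_eq_mul, ← Finset.card_univ]
  refine Finset.sum_le_card_nsmul _ _ _ fun b _ => ?_
  rw [abs_mul, Finset.abs_prod]
  gcongr with i
  · exact PiLp.norm_apply_le (v i) (b i)
  · exact PiLp.norm_apply_le (classicalGradient m w z) b

end SmoothFunctions

/-! ### Forward differences bounded by integrals of derivatives. -/

section FiniteDifferences

lemma enorm_sub_le_lintegral_deriv {f f' : ℝ → ℝ} (hf : ∀ t, HasDerivAt f (f' t) t)
    (hf' : Continuous f') {a b : ℝ} (hab : a ≤ b) :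
    ‖f b - f a‖ₑ ≤ ∫⁻ t in Ioc a b, ‖f' t‖ₑ := by
  rw [← intervalIntegral.integral_eq_sub_of_hasDerivAt (fun t _ => hf t)
    (hf'.intervalIntegrable a b), intervalIntegral.integral_of_le hab]
  exact enorm_integral_le_lintegral_enorm _

/-- Induct by applying the estimate to the first difference of `g`. Its top derivative is a unit
increment, bounded by one integral of the next derivative; integrating that constant over length `m
+ 1` turns `m!` into `(m + 1)!`. -/
lemma enorm_fwdDiff_iter_le (m : ℕ) {g : ℕ → ℝ → ℝ} (hg : ∀ l t, HasDerivAt (g l) (g (l + 1) t) t)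
    (a : ℝ) :
    ‖(fwdDiff (1 : ℝ))^[m + 1] (g 0) a‖ₑ
      ≤ (m.factorial : ℝ≥0∞) * ∫⁻ t in Ioc a (a + (m + 1 : ℕ)), ‖g (m + 1) t‖ₑ := by
  have hcont {g : ℕ → ℝ → ℝ} (hg : ∀ l t, HasDerivAt (g l) (g (l + 1) t) t) (l : ℕ) :
      Continuous (g l) := continuous_iff_continuousAt.2 fun t => (hg l t).continuousAt
  induction m generalizing g with
  | zero =>
    simpa [fwdDiff] using enorm_sub_le_lintegral_deriv (hg 0) (hcont hg 1)
      (by linarith : a ≤ a + 1)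
  | succ m ih =>
    have hh : ∀ l t, HasDerivAt (fun s => g l (s + 1) - g l s) (g (l + 1) (t + 1) - g (l + 1) t) t :=
      fun l t => ((hg l (t + 1)).comp_add_const t 1).sub (hg l t)
    have h1 := ih (g := fun l s => g l (s + 1) - g l s) hh
    rw [Function.iterate_succ_apply]
    refine h1.trans ?_
    have hin : ∀ t ∈ Ioc a (a + (m + 1 : ℕ)), ‖g (m + 1) (t + 1) - g (m + 1) t‖ₑ
        ≤ ∫⁻ s in Ioc a (a + (m + 1 + 1 : ℕ)), ‖g (m + 1 + 1) s‖ₑ := by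
      intro t ht
      refine (enorm_sub_le_lintegral_deriv (hg (m + 1)) (hcont hg _)
        (by linarith : t ≤ t + 1)).trans (lintegral_mono_set (Ioc_subset_Ioc ht.1.le ?_))
      have := ht.2
      push_cast at this ⊢
      linarith
    calc (m.factorial : ℝ≥0∞) * ∫⁻ t in Ioc a (a + (m + 1 : ℕ)), ‖g (m + 1) (t + 1) - g (m + 1) t‖ₑ
        ≤ m.factorial * ∫⁻ _ in Ioc a (a + (m + 1 : ℕ)),
          ∫⁻ s in Ioc a (a + (m + 1 + 1 : ℕ)), ‖g (m + 1 + 1) s‖ₑ := by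
          gcongr 1
          exact setLIntegral_mono' measurableSet_Ioc hin
      _ = ((m + 1).factorial : ℝ≥0∞) *
          ∫⁻ s in Ioc a (a + (m + 1 + 1 : ℕ)), ‖g (m + 1 + 1) s‖ₑ := by
          rw [setLIntegral_const, Real.volume_Ioc, add_sub_cancel_left, ENNReal.ofReal_natCast,
            Nat.factorial_succ]
          push_cast
          ring

end FiniteDifferences

/-! ### The two-scale pointwise estimate for smooth functions. -/

section PointwiseEstimate

variable {n : ℕ}

lemma setLIntegral_comp_affine_le_maximal {g : Eucl n → ℝ≥0∞} (hg : Measurable g) (x : Eucl n)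
    {c : ℝ} (hc : 0 < c) :
    ∫⁻ y in closedBall 0 1, g (x + c • y)
      ≤ ENNReal.ofReal (2 ^ n) * volume (closedBall (0 : Eucl n) 1) * maximal g x := by
  have hcn : (0 : ℝ) < c ^ n := by positivity
  have hcball : volume (closedBall x c)
      = ENNReal.ofReal (c ^ n) * volume (closedBall (0 : Eucl n) 1) := by
    rw [← mul_one c, volume_closedBall_mul x hc.le zero_le_one,
      Measure.addHaar_closedBall_center, mul_one]
  have hind : ∫⁻ y in closedBall (0 : Eucl n) 1, g (x + c • y)
      = ∫⁻ y, (closedBall x c).indicator g (x + c • y) := by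
    rw [← lintegral_indicator measurableSet_closedBall]
    refine lintegral_congr fun y => ?_
    have : y ∈ closedBall (0 : Eucl n) 1 ↔ x + c • y ∈ closedBall x c := by
      rw [mem_closedBall_zero_iff, mem_closedBall, dist_eq_norm, add_sub_cancel_left, norm_smul,
        Real.norm_of_nonneg hc.le]
      exact (mul_le_iff_le_one_right hc).symm
    by_cases hy : y ∈ closedBall (0 : Eucl n) 1
    · rw [indicator_of_mem hy, indicator_of_mem (this.1 hy)]
    · rw [indicator_of_notMem hy, indicator_of_notMem fun h => hy (this.2 h)]
  have hmeas : Measurable fun z => (closedBall x c).indicator g (x + z) :=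
    (hg.indicator measurableSet_closedBall).comp (measurable_const_add x)
  have hscale : ∫⁻ y, (closedBall x c).indicator g (x + c • y)
      = ENNReal.ofReal (c ^ n)⁻¹ * ∫⁻ z in closedBall x c, g z := by
    rw [← lintegral_map hmeas (measurable_const_smul c), Measure.map_addHaar_smul _ hc.ne',
      lintegral_smul_measure, lintegral_add_left_eq_self (μ := volume),
      lintegral_indicator measurableSet_closedBall]
    simp [abs_of_pos hc]
  rw [hind, hscale]
  refine (mul_le_mul_right (setLIntegral_closedBall_le_maximal g x hc) _).trans (le_of_eq ?_)
  rw [hcball, ← mul_assoc, ← mul_assoc, ← mul_assoc,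
    mul_right_comm _ _ (ENNReal.ofReal (c ^ n)), ← ENNReal.ofReal_mul (by positivity),
    inv_mul_cancel₀ hcn.ne', ENNReal.ofReal_one, one_mul]

/-- The multi-vector `(y, …, y, e_{a 0}, …, e_{a (j-1)})` with `l` copies of `y`. -/
noncomputable def directions {j : ℕ} (a : Fin j → Fin n) (y : Eucl n) :
    (l : ℕ) → Fin (j + l) → Eucl n
  | 0 => fun i => EuclideanSpace.single (a i) 1
  | l + 1 => (Fin.cons y (directions a y l) : Fin (j + l + 1) → Eucl n)

lemma prod_norm_directions {j : ℕ} (a : Fin j → Fin n) (y : Eucl n) (l : ℕ) :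
    ∏ i, ‖directions a y l i‖ = ‖y‖ ^ l := by
  induction l with
  | zero =>
    simp [directions]
  | succ l ih =>
    have h : ∏ i : Fin (j + l + 1), ‖directions a y (l + 1) i‖
        = ‖y‖ * ∏ i, ‖directions a y l i‖ := by
      rw [Fin.prod_univ_succ]
      simp [directions]
    exact h.trans (by rw [ih, pow_succ'])

lemma hasDerivAt_iteratedFDeriv_directions {w : Eucl n → ℝ} (hw : ContDiff ℝ ∞ w) {j : ℕ}
    (a : Fin j → Fin n) (x y : Eucl n) (l : ℕ) (t : ℝ) :
    HasDerivAt (fun s : ℝ => iteratedFDeriv ℝ (j + l) w (x + s • y) (directions a y l))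
      (iteratedFDeriv ℝ (j + (l + 1)) w (x + t • y) (directions a y (l + 1))) t := by
  have hline : HasDerivAt (fun s : ℝ => x + s • y) y t := by
    simpa using ((hasDerivAt_id t).smul_const y).const_add x
  have h := ((differentiable_iteratedFDeriv_apply hw (directions a y l)) (x + t • y)).hasFDerivAt
  have := h.comp_hasDerivAt t hline
  rwa [← iteratedFDeriv_cons_apply hw] at this

lemma enorm_fwdDiff_partialDeriv_le {w : Eucl n → ℝ} (hw : ContDiff ℝ ∞ w) {j : ℕ}
    (a : Fin j → Fin n) (m : ℕ) (x y : Eucl n) :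
    ‖(fwdDiff (1 : ℝ))^[m + 1] (fun s : ℝ => partialDeriv a w (x + s • y)) 0‖ₑ
      ≤ ENNReal.ofReal (m.factorial * Fintype.card (Fin (j + (m + 1)) → Fin n) * ‖y‖ ^ (m + 1)) *
        ∫⁻ t in Ioc 0 ((m + 1 : ℕ) : ℝ), ‖classicalGradient (j + (m + 1)) w (x + t • y)‖ₑ := by
  have h := enorm_fwdDiff_iter_le m
    (g := fun l s => iteratedFDeriv ℝ (j + l) w (x + s • y) (directions a y l))
    (fun l t => hasDerivAt_iteratedFDeriv_directions hw a x y l t) 0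
  refine h.trans ?_
  rw [zero_add, mul_assoc, ENNReal.ofReal_mul (by positivity), ENNReal.ofReal_natCast, mul_assoc]
  gcongr
  rw [← lintegral_const_mul' _ _ ENNReal.ofReal_ne_top]
  refine lintegral_mono fun t => ?_
  have := abs_iteratedFDeriv_apply_le w (x + t • y) (directions a y (m + 1))
  rw [prod_norm_directions, ← mul_assoc] at this
  rw [← ofReal_norm, ← ofReal_norm, ← ENNReal.ofReal_mul (by positivity)]
  exact ENNReal.ofReal_le_ofReal this

/-- A fixed smooth function with integral one supported in the unit ball. -/
noncomputable def unitBump (n : ℕ) : ContDiffBump (0 : Eucl n) where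
  rIn := 1 / 2
  rOut := 1
  rIn_pos := by norm_num
  rIn_lt_rOut := by norm_num

lemma exists_kernel (n j : ℕ) : ∃ φ : Eucl n → ℝ, ContDiff ℝ ∞ φ ∧ HasCompactSupport φ ∧
    ∫ y, φ y = 1 ∧ ∃ K : ℝ, 0 ≤ K ∧
      (∀ y, |φ y| ≤ (closedBall 0 1).indicator (fun _ => K) y) ∧
      ∀ (a : Fin j → Fin n) y, |partialDeriv a φ y| ≤ (closedBall 0 1).indicator (fun _ => K) y := by
  set φ := (unitBump n).normed volume with hφ
  have hs : ContDiff ℝ ∞ φ := (unitBump n).contDiff_normed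
  have hc : HasCompactSupport φ := (unitBump n).hasCompactSupport_normed
  have hsupp : tsupport φ = closedBall 0 1 := (unitBump n).tsupport_normed_eq
  obtain ⟨K₀, hK₀⟩ := hs.continuous.bounded_above_of_compact_support hc
  have hex (a : Fin j → Fin n) : ∃ K, ∀ y, ‖partialDeriv a φ y‖ ≤ K :=
    (contDiff_partialDeriv hs a).continuous.bounded_above_of_compact_support
      (hasCompactSupport_partialDeriv hc a)
  choose K₁ hK₁ using hex
  have hK₁0 (a) : 0 ≤ K₁ a := (norm_nonneg _).trans (hK₁ a 0)
  have hK₀0 : 0 ≤ K₀ := (norm_nonneg _).trans (hK₀ 0)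
  refine ⟨φ, hs, hc, (unitBump n).integral_normed, K₀ + ∑ a, K₁ a,
    add_nonneg hK₀0 (Finset.sum_nonneg fun a _ => hK₁0 a), fun y => ?_, fun a y => ?_⟩
  · by_cases hy : y ∈ closedBall (0 : Eucl n) 1
    · rw [indicator_of_mem hy]
      exact (hK₀ y).trans (le_add_of_nonneg_right (Finset.sum_nonneg fun a _ => hK₁0 a))
    · have hy' : φ y = 0 := image_eq_zero_of_notMem_tsupport (by rwa [hsupp])
      rw [indicator_of_notMem hy, hy', abs_zero]
  · by_cases hy : y ∈ closedBall (0 : Eucl n) 1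
    · rw [indicator_of_mem hy]
      exact (hK₁ a y).trans ((Finset.single_le_sum (fun a _ => hK₁0 a) (Finset.mem_univ a)).trans
        (le_add_of_nonneg_left hK₀0))
    · rw [indicator_of_notMem hy]
      have : y ∉ tsupport (iteratedFDeriv ℝ j φ) :=
        fun h => hy (hsupp ▸ tsupport_iteratedFDeriv_subset j h)
      simp [partialDeriv, image_eq_zero_of_notMem_tsupport this]

lemma enorm_integral_mul_le_of_indicator {ψ f : Eucl n → ℝ} {K : ℝ}
    (hψ : ∀ y, |ψ y| ≤ (closedBall 0 1).indicator (fun _ => K) y) :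
    ‖∫ y, ψ y * f y‖ₑ ≤ ENNReal.ofReal K * ∫⁻ y in closedBall 0 1, ‖f y‖ₑ := by
  refine (enorm_integral_le_lintegral_enorm _).trans ?_
  rw [← lintegral_const_mul' _ _ ENNReal.ofReal_ne_top,
    ← lintegral_indicator measurableSet_closedBall]
  refine lintegral_mono fun y => ?_
  have h := hψ y
  by_cases hy : y ∈ closedBall (0 : Eucl n) 1
  · rw [indicator_of_mem hy] at h ⊢
    rw [enorm_mul]
    gcongr
    rw [← ofReal_norm]
    exact ENNReal.ofReal_le_ofReal h
  · rw [indicator_of_notMem hy] at h ⊢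
    simp [abs_nonpos_iff.1 h]

/-- Solve the averaged forward difference for its node at `0`. The remaining nodes give the term in
`w`, the difference itself the term in the top gradient. -/
lemma exists_partialDeriv_le_maximal (n j m : ℕ) : ∃ C : ℝ≥0∞, C ≠ ⊤ ∧
    ∀ w : Eucl n → ℝ, ContDiff ℝ ∞ w → ∀ (a : Fin j → Fin n) (x : Eucl n) (ε : ℝ), 0 < ε →
      ‖partialDeriv a w x‖ₑ ≤ C * (ENNReal.ofReal ((ε ^ j)⁻¹) * maximal (fun y => ‖w y‖ₑ) x +
        ENNReal.ofReal (ε ^ (m + 1)) *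
          maximal (fun y => ‖classicalGradient (j + (m + 1)) w y‖ₑ) x) := by
  obtain ⟨φ, hφ, hφc, hφ1, K, hK, hφK, hφK'⟩ := exists_kernel n j
  set A := ENNReal.ofReal (2 ^ n) * volume (closedBall (0 : Eucl n) 1) with hA
  have hAt : A ≠ ⊤ := ENNReal.mul_ne_top ENNReal.ofReal_ne_top (volume_closedBall_ne_top _ _)
  let c : ℕ → ℝ := fun i => ((-1 : ℤ) ^ (m + 1 - i) * ((m + 1).choose i : ℤ) : ℤ)
  set N := ENNReal.ofReal (m.factorial * Fintype.card (Fin (j + (m + 1)) → Fin n)) with hN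
  set C₁ := ∑ i ∈ Finset.range (m + 1), ‖c (i + 1)‖ₑ * (ENNReal.ofReal K * A) with hC₁
  set C₂ := ENNReal.ofReal K * (N * ((m + 1 : ℕ) * A)) with hC₂
  have hC₁t : C₁ ≠ ⊤ := ENNReal.sum_ne_top.2 fun i _ =>
    ENNReal.mul_ne_top enorm_ne_top (ENNReal.mul_ne_top ENNReal.ofReal_ne_top hAt)
  have hC₂t : C₂ ≠ ⊤ := ENNReal.mul_ne_top ENNReal.ofReal_ne_top
    (ENNReal.mul_ne_top ENNReal.ofReal_ne_top (ENNReal.mul_ne_top (ENNReal.natCast_ne_top _) hAt))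
  refine ⟨C₁ + C₂, ENNReal.add_ne_top.2 ⟨hC₁t, hC₂t⟩, fun w hw a x ε hε => ?_⟩
  set M₁ := maximal (fun y => ‖w y‖ₑ) x
  set M₂ := maximal (fun y => ‖classicalGradient (j + (m + 1)) w y‖ₑ) x
  have haw := contDiff_partialDeriv hw a
  let I : ℝ → ℝ := fun s => ∫ y, φ y * partialDeriv a w (x + s • y)
  have hint (s : ℝ) : Integrable fun y => φ y * partialDeriv a w (x + s • y) :=
    (hφ.continuous.mul (haw.continuous.comp (by fun_prop))).integrable_of_hasCompactSupport
      hφc.mul_right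
  -- Integration by parts shifts the `j` derivatives to the kernel, and rescaling by `s` yields
  -- `s^(-j)`.
  have hlow (s : ℝ) (hs : 0 < s) : ‖I s‖ₑ
      ≤ ENNReal.ofReal ((s ^ j)⁻¹) * (ENNReal.ofReal K * (A * M₁)) := by
    have hws : ContDiff ℝ ∞ fun y => w (x + s • y) := hw.comp (by fun_prop)
    have hparts := integral_mul_partialDeriv hws hφ hφc a
    simp_rw [partialDeriv_comp_affine hw, mul_assoc, integral_const_mul] at hparts
    have hI : I s = (s ^ j)⁻¹ * ((-1) ^ j * ∫ y, partialDeriv a φ y * w (x + s • y)) := by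
      have e1 : ∫ y, partialDeriv a φ y * w (x + s • y)
          = ∫ y, w (x + s • y) * partialDeriv a φ y := by simp_rw [mul_comm]
      have e2 : I s = ∫ y, partialDeriv a w (x + s • y) * φ y := by
        simp only [I]
        simp_rw [mul_comm]
      have e3 : ((-1 : ℝ) ^ j) * (-1) ^ j = 1 := by rw [← mul_pow]; simp
      rw [e1, hparts, ← e2, ← mul_assoc ((-1 : ℝ) ^ j), e3, one_mul, ← mul_assoc,
        inv_mul_cancel₀ (by positivity), one_mul]
    rw [hI, enorm_mul, enorm_mul]
    have e4 : ‖(-1 : ℝ) ^ j‖ₑ = 1 := by simp [enorm_pow]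
    rw [e4, one_mul, Real.enorm_of_nonneg (by positivity)]
    gcongr
    refine (enorm_integral_mul_le_of_indicator (hφK' a)).trans ?_
    gcongr
    exact setLIntegral_comp_affine_le_maximal (g := fun y => ‖w y‖ₑ)
      (by have := hw.continuous; fun_prop) x hs
  let D : Eucl n → ℝ := fun y =>
    (fwdDiff (1 : ℝ))^[m + 1] (fun s : ℝ => partialDeriv a w (x + s • (ε • y))) 0
  have hD (y : Eucl n) : D y
      = ∑ i ∈ Finset.range (m + 1 + 1), c i * partialDeriv a w (x + (i * ε) • y) := by
    simp only [D, fwdDiff_iter_eq_sum_shift]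
    refine Finset.sum_congr rfl fun i _ => ?_
    rw [zsmul_eq_mul]
    simp [c, smul_smul]
  have hsum : ∫ y, φ y * D y = (∑ i ∈ Finset.range (m + 1), c (i + 1) * I ((i + 1 : ℕ) * ε))
      + c 0 * partialDeriv a w x := by
    have h1 : ∫ y, φ y * D y = ∑ i ∈ Finset.range (m + 1 + 1), c i * I (i * ε) := by
      simp_rw [hD, Finset.mul_sum, mul_left_comm (φ _)]
      rw [integral_finsetSum _ fun (i : ℕ) _ => (hint (i * ε)).const_mul (c i)]
      simp_rw [integral_const_mul]
      rfl
    have h0 : I ((0 : ℕ) * ε) = partialDeriv a w x := by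
      simp [I, integral_mul_const, hφ1]
    rw [h1, Finset.sum_range_succ', h0]
  -- The binomial coefficient at node `0` is a sign, so nothing is lost in isolating this term.
  have hc0 : ‖c 0 * partialDeriv a w x‖ₑ = ‖partialDeriv a w x‖ₑ := by
    simp [c, enorm_mul, enorm_pow]
  have hrem : ‖∫ y, φ y * D y‖ₑ ≤ ENNReal.ofReal (ε ^ (m + 1)) * (C₂ * M₂) := by
    refine (enorm_integral_mul_le_of_indicator hφK).trans ?_
    have hcg := continuous_classicalGradient hw (j + (m + 1))
    have hDy : ∀ y ∈ closedBall (0 : Eucl n) 1, ‖D y‖ₑ ≤ N * ENNReal.ofReal (ε ^ (m + 1)) *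
        ∫⁻ t in Ioc 0 ((m + 1 : ℕ) : ℝ),
          ‖classicalGradient (j + (m + 1)) w (x + (t * ε) • y)‖ₑ := by
      intro y hy
      refine (enorm_fwdDiff_partialDeriv_le hw a m x (ε • y)).trans ?_
      simp_rw [smul_smul]
      gcongr
      rw [hN, ← ENNReal.ofReal_mul (by positivity)]
      refine ENNReal.ofReal_le_ofReal ?_
      gcongr
      rw [norm_smul, Real.norm_of_nonneg hε.le]
      exact mul_le_of_le_one_right hε.le (mem_closedBall_zero_iff.1 hy)
    calc ENNReal.ofReal K * ∫⁻ y in closedBall 0 1, ‖D y‖ₑ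
        ≤ ENNReal.ofReal K * ∫⁻ y in closedBall 0 1, N * ENNReal.ofReal (ε ^ (m + 1)) *
            ∫⁻ t in Ioc 0 ((m + 1 : ℕ) : ℝ),
              ‖classicalGradient (j + (m + 1)) w (x + (t * ε) • y)‖ₑ := by
          gcongr 1
          exact setLIntegral_mono' measurableSet_closedBall hDy
      -- Integrating in `y` first turns each `t` into a ball average at radius `tε`, bounded
      -- uniformly in `t`; no singular kernel appears.
      _ = ENNReal.ofReal K * (N * ENNReal.ofReal (ε ^ (m + 1)) *
            ∫⁻ t in Ioc 0 ((m + 1 : ℕ) : ℝ), ∫⁻ y in closedBall 0 1,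
              ‖classicalGradient (j + (m + 1)) w (x + (t * ε) • y)‖ₑ) := by
          rw [lintegral_const_mul' _ _
            (ENNReal.mul_ne_top ENNReal.ofReal_ne_top ENNReal.ofReal_ne_top),
            lintegral_lintegral_swap]
          refine Continuous.aemeasurable ?_
          exact (hcg.comp (by fun_prop)).enorm
      _ ≤ ENNReal.ofReal K * (N * ENNReal.ofReal (ε ^ (m + 1)) *
            ∫⁻ _ in Ioc 0 ((m + 1 : ℕ) : ℝ), A * M₂) := by
          gcongr 2
          refine setLIntegral_mono' measurableSet_Ioc fun t ht => ?_
          exact setLIntegral_comp_affine_le_maximal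
            (g := fun y => ‖classicalGradient (j + (m + 1)) w y‖ₑ)
            hcg.enorm.measurable x (mul_pos ht.1 hε)
      _ = ENNReal.ofReal (ε ^ (m + 1)) * (C₂ * M₂) := by
          rw [setLIntegral_const, Real.volume_Ioc, sub_zero, ENNReal.ofReal_natCast, hC₂]
          ring
  have hlowsum : ‖∑ i ∈ Finset.range (m + 1), c (i + 1) * I ((i + 1 : ℕ) * ε)‖ₑ
      ≤ ENNReal.ofReal ((ε ^ j)⁻¹) * (C₁ * M₁) := by
    refine (enorm_sum_le _ _).trans ?_
    rw [hC₁, Finset.sum_mul, Finset.mul_sum]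
    refine Finset.sum_le_sum fun i _ => ?_
    rw [enorm_mul]
    -- The nonzero nodes are at least `1`, so their factors `s^(-j)` are at most `ε^(-j)`.
    have h1 : ε ≤ (i + 1 : ℕ) * ε := by
      refine le_mul_of_one_le_left hε.le ?_
      push_cast
      linarith [(Nat.cast_nonneg i : (0 : ℝ) ≤ i)]
    have h2 := hlow ((i + 1 : ℕ) * ε) (hε.trans_le h1)
    calc ‖c (i + 1)‖ₑ * ‖I ((i + 1 : ℕ) * ε)‖ₑ
        ≤ ‖c (i + 1)‖ₑ * (ENNReal.ofReal ((ε ^ j)⁻¹) * (ENNReal.ofReal K * (A * M₁))) := by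
          gcongr
          refine h2.trans ?_
          gcongr
      _ = _ := by ring
  calc ‖partialDeriv a w x‖ₑ = ‖(∫ y, φ y * D y)
        - ∑ i ∈ Finset.range (m + 1), c (i + 1) * I ((i + 1 : ℕ) * ε)‖ₑ := by
        rw [hsum, add_sub_cancel_left, hc0]
    _ ≤ ENNReal.ofReal (ε ^ (m + 1)) * (C₂ * M₂) + ENNReal.ofReal ((ε ^ j)⁻¹) * (C₁ * M₁) :=
        enorm_sub_le.trans (add_le_add hrem hlowsum)
    _ ≤ (C₁ + C₂) * (ENNReal.ofReal ((ε ^ j)⁻¹) * M₁ + ENNReal.ofReal (ε ^ (m + 1)) * M₂) := by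
        rw [mul_add, add_comm, mul_left_comm, mul_left_comm _ C₂, ← mul_assoc C₁, ← mul_assoc C₂,
          mul_assoc C₁, mul_assoc C₂]
        gcongr
        · exact le_self_add
        · exact le_add_self

end PointwiseEstimate

open ContinuousLinearMap
open scoped Convolution

/-! ### Passage from smooth functions to weak gradients. -/

section Mollification

variable {n : ℕ}

lemma contDiff_convolution {η u : Eucl n → ℝ} (hη : ContDiff ℝ ∞ η) (hc : HasCompactSupport η)
    (hu : LocallyIntegrable u volume) : ContDiff ℝ ∞ (η ⋆[lsmul ℝ ℝ, volume] u) :=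
  hc.contDiff_convolution_left (n := (⊤ : ℕ∞)) (lsmul ℝ ℝ) hη hu

lemma fderiv_convolution_apply {η u : Eucl n → ℝ} (hη : ContDiff ℝ ∞ η) (hc : HasCompactSupport η)
    (hu : LocallyIntegrable u volume) (x v : Eucl n) :
    fderiv ℝ (η ⋆[lsmul ℝ ℝ, volume] u) x v
      = ((fun y => fderiv ℝ η y v) ⋆[lsmul ℝ ℝ, volume] u) x := by
  have h1 : ContDiff ℝ 1 η := hη.of_le (by exact_mod_cast le_top)
  rw [(hc.hasFDerivAt_convolution_left (lsmul ℝ ℝ) h1 hu x).fderiv]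
  have hex := (hc.fderiv ℝ).convolutionExists_left (precompL (Eucl n) (lsmul ℝ ℝ))
    (h1.continuous_fderiv one_ne_zero) hu x
  rw [convolution_def, ContinuousLinearMap.integral_apply hex, convolution_def]
  rfl

lemma partialDeriv_convolution {η u : Eucl n → ℝ} (hη : ContDiff ℝ ∞ η) (hc : HasCompactSupport η)
    (hu : LocallyIntegrable u volume) {m : ℕ} (a : Fin m → Fin n) :
    partialDeriv a (η ⋆[lsmul ℝ ℝ, volume] u) = partialDeriv a η ⋆[lsmul ℝ ℝ, volume] u := by
  induction m with
  | zero => simp only [partialDeriv_zero]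
  | succ m ih =>
    ext x
    rw [partialDeriv_succ (contDiff_convolution hη hc hu), ih, fderiv_convolution_apply
      (contDiff_partialDeriv hη _) (hasCompactSupport_partialDeriv hc _) hu]
    congr 1
    ext y
    rw [partialDeriv_succ hη]

/-- Test the weak gradient against `y ↦ η(x - y)`; the reflection contributes `(-1)^m`, which
cancels the sign in the definition. -/
lemma IsWeakGradient.partialDeriv_convolution_eq {m : ℕ} {u : Eucl n → ℝ} {G : Eucl n → Tensor n m}
    (hG : IsWeakGradient m u G) (hu : LocallyIntegrable u volume) {η : Eucl n → ℝ}
    (hη : ContDiff ℝ ∞ η) (hc : HasCompactSupport η) (a : Fin m → Fin n) (x : Eucl n) :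
    partialDeriv a (η ⋆[lsmul ℝ ℝ, volume] u) x
      = (η ⋆[lsmul ℝ ℝ, volume] fun y => G y a) x := by
  have hφ : ContDiff ℝ ∞ fun y => η (x + (-1 : ℝ) • y) := hη.comp (by fun_prop)
  have hφc : HasCompactSupport fun y => η (x + (-1 : ℝ) • y) := by
    refine hc.comp_homeomorph
      ((Homeomorph.smulOfNeZero (-1 : ℝ) (by norm_num)).trans (Homeomorph.addLeft x))
  have h := hG.integral_eq _ hφ hφc a
  simp_rw [partialDeriv_comp_affine hη, mul_left_comm (u _), integral_const_mul] at h
  have h' := mul_left_cancel₀ (pow_ne_zero m (by norm_num : (-1 : ℝ) ≠ 0)) h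
  rw [partialDeriv_convolution hη hc hu, convolution_eq_swap, convolution_eq_swap]
  simp only [neg_smul, one_smul, ← sub_eq_add_neg] at h'
  simpa [mul_comm] using h'

/-- A sequence of bump functions shrinking to the origin. -/
noncomputable def shrinkingBump (n i : ℕ) : ContDiffBump (0 : Eucl n) where
  rIn := 1 / (2 * (i + 1))
  rOut := 1 / (i + 1)
  rIn_pos := by positivity
  rIn_lt_rOut := by
    apply one_div_lt_one_div_of_lt <;> linarith [(Nat.cast_nonneg i : (0 : ℝ) ≤ i)]

lemma shrinkingBump_rOut_le (n i : ℕ) :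
    (shrinkingBump n i).rOut ≤ 2 * (shrinkingBump n i).rIn := by
  refine le_of_eq ?_
  simp only [shrinkingBump]
  field_simp

lemma tendsto_shrinkingBump_rOut (n : ℕ) :
    Tendsto (fun i => (shrinkingBump n i).rOut) atTop (𝓝 0) :=
  tendsto_one_div_add_atTop_nhds_zero_nat

/-- The normalized bump is at most `2ⁿ` over the volume of its support ball, as its outer radius is
twice the inner one. The other `2ⁿ` comes from the dyadic radii. -/
lemma enorm_convolution_shrinkingBump_le (g : Eucl n → ℝ) (i : ℕ) (x : Eucl n) :
    ‖((shrinkingBump n i).normed volume ⋆[lsmul ℝ ℝ, volume] g) x‖ₑ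
      ≤ ENNReal.ofReal (2 ^ n) * ENNReal.ofReal (2 ^ n) * maximal (fun y => ‖g y‖ₑ) x := by
  set b := shrinkingBump n i
  have hr : 0 < b.rOut := b.rOut_pos
  set V := volume (closedBall (0 : Eucl n) b.rOut) with hV
  have hV0 : V ≠ 0 := volume_closedBall_ne_zero _ hr
  have hVt : V ≠ ⊤ := volume_closedBall_ne_top _ _
  have hbound (z : Eucl n) : ‖b.normed volume z‖ₑ ≤ ENNReal.ofReal (2 ^ n) / V := by
    have h := b.normed_le_div_measure_closedBall_rOut volume 2 (shrinkingBump_rOut_le n i) z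
    rw [Real.enorm_of_nonneg (b.nonneg_normed z)]
    refine (ENNReal.ofReal_le_ofReal h).trans (le_of_eq ?_)
    rw [Measure.real, ← hV, ENNReal.ofReal_div_of_pos (ENNReal.toReal_pos hV0 hVt),
      ENNReal.ofReal_toReal hVt]
    simp
  rw [convolution_eq_swap]
  calc ‖∫ t, lsmul ℝ ℝ (b.normed volume (x - t)) (g t)‖ₑ
      ≤ ∫⁻ t, ‖lsmul ℝ ℝ (b.normed volume (x - t)) (g t)‖ₑ := enorm_integral_le_lintegral_enorm _
    _ ≤ ∫⁻ t in closedBall x b.rOut, ENNReal.ofReal (2 ^ n) / V * ‖g t‖ₑ := by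
        rw [← lintegral_indicator measurableSet_closedBall]
        refine lintegral_mono fun t => ?_
        by_cases ht : t ∈ closedBall x b.rOut
        · rw [indicator_of_mem ht, lsmul_apply, smul_eq_mul, enorm_mul]
          gcongr
          exact hbound _
        · have hz : b.normed volume (x - t) = 0 := by
            refine image_eq_zero_of_notMem_tsupport ?_
            rw [b.tsupport_normed_eq]
            rwa [mem_closedBall_zero_iff, ← dist_eq_norm, dist_comm]
          simp [hz]
    _ = ENNReal.ofReal (2 ^ n) / V * ∫⁻ t in closedBall x b.rOut, ‖g t‖ₑ :=
        lintegral_const_mul' _ _ (ENNReal.div_ne_top ENNReal.ofReal_ne_top hV0)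
    _ ≤ ENNReal.ofReal (2 ^ n) / V * (ENNReal.ofReal (2 ^ n) * V * maximal (fun y => ‖g y‖ₑ) x) := by
        gcongr
        refine (setLIntegral_closedBall_le_maximal _ x hr).trans (le_of_eq ?_)
        rw [Measure.addHaar_closedBall_center]
    _ = ENNReal.ofReal (2 ^ n) * ENNReal.ofReal (2 ^ n) * maximal (fun y => ‖g y‖ₑ) x := by
        rw [mul_comm (ENNReal.ofReal (2 ^ n)) V, mul_assoc V, ← mul_assoc,
          ENNReal.div_mul_cancel hV0 hVt, mul_assoc]

lemma enorm_tensor_le_sum {m : ℕ} (T : Tensor n m) : ‖T‖ₑ ≤ ∑ b, ‖T b‖ₑ := by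
  have h : T = ∑ b, T b • EuclideanSpace.single b (1 : ℝ) := by
    simpa using ((EuclideanSpace.basisFun (Fin m → Fin n) ℝ).sum_repr T).symm
  calc ‖T‖ₑ = ‖∑ b, T b • EuclideanSpace.single b (1 : ℝ)‖ₑ := by rw [← h]
    _ ≤ ∑ b, ‖T b • EuclideanSpace.single b (1 : ℝ)‖ₑ := enorm_sum_le _ _
    _ = ∑ b, ‖T b‖ₑ := by
      refine Finset.sum_congr rfl fun b _ => ?_
      rw [enorm_smul, ← ofReal_norm (EuclideanSpace.single b (1 : ℝ))]
      simp

lemma enorm_apply_le_enorm {m : ℕ} (T : Tensor n m) (b : Fin m → Fin n) : ‖T b‖ₑ ≤ ‖T‖ₑ := by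
  rw [← ofReal_norm, ← ofReal_norm]
  exact ENNReal.ofReal_le_ofReal (PiLp.norm_apply_le T b)

lemma locallyIntegrable_apply {m : ℕ} {G : Eucl n → Tensor n m}
    (hG : LocallyIntegrable G volume) (a : Fin m → Fin n) :
    LocallyIntegrable (fun x => G x a) volume := by
  refine hG.mono ?_ (ae_of_all _ fun x => PiLp.norm_apply_le (G x) a)
  exact (EuclideanSpace.proj (𝕜 := ℝ) a).continuous.comp_aestronglyMeasurable
    hG.aestronglyMeasurable

/-- The pointwise interpolation inequality for weak gradients, with a free scale parameter. -/
lemma exists_weakGradient_le_maximal (n j m : ℕ) : ∃ C : ℝ≥0∞, C ≠ ⊤ ∧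
    ∀ u : Eucl n → ℝ, LocallyIntegrable u volume →
    ∀ (Gj : Eucl n → Tensor n j) (Gk : Eucl n → Tensor n (j + (m + 1))),
      IsWeakGradient j u Gj → IsWeakGradient (j + (m + 1)) u Gk →
      ∀ᵐ x, ∀ ε : ℝ, 0 < ε → ‖Gj x‖ₑ ≤ C *
        (ENNReal.ofReal ((ε ^ j)⁻¹) * maximal (maximal fun y => ‖u y‖ₑ) x +
          ENNReal.ofReal (ε ^ (m + 1)) * maximal (maximal fun y => ‖Gk y‖ₑ) x) := by
  obtain ⟨C, hC, h⟩ := exists_partialDeriv_le_maximal n j m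
  set L := ENNReal.ofReal (2 ^ n) * ENNReal.ofReal (2 ^ n)
  have hL : L ≠ ⊤ := ENNReal.mul_ne_top ENNReal.ofReal_ne_top ENNReal.ofReal_ne_top
  -- The added `1` ensures `N ≥ 1` even for `n = 0`, so one constant serves both terms.
  set N : ℝ≥0∞ := 1 + Fintype.card (Fin (j + (m + 1)) → Fin n) with hN
  have hNt : N ≠ ⊤ := ENNReal.add_ne_top.2 ⟨ENNReal.one_ne_top, ENNReal.natCast_ne_top _⟩
  have hNL : N * L ≠ ⊤ := ENNReal.mul_ne_top hNt hL
  refine ⟨Fintype.card (Fin j → Fin n) * (C * (N * L)), ENNReal.mul_ne_top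
    (ENNReal.natCast_ne_top _) (ENNReal.mul_ne_top hC hNL), fun u hu Gj Gk hGj hGk => ?_⟩
  set M₁ := maximal fun y => ‖u y‖ₑ
  set M₂ := maximal fun y => ‖Gk y‖ₑ
  -- The exceptional null set comes from Lebesgue differentiation alone, so it does not depend on
  -- `ε`.
  have hconv : ∀ᵐ x, ∀ a, Tendsto (fun i => ((shrinkingBump n i).normed volume
      ⋆[lsmul ℝ ℝ, volume] fun y => Gj y a) x) atTop (𝓝 (Gj x a)) := by
    refine ae_all_iff.2 fun a => ?_
    exact ContDiffBump.ae_convolution_tendsto_right_of_locallyIntegrable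
      (tendsto_shrinkingBump_rOut n) (Eventually.of_forall fun i => shrinkingBump_rOut_le n i)
      (locallyIntegrable_apply hGj.locallyIntegrable a)
  filter_upwards [hconv] with x hx ε hε
  have hcomp (a : Fin j → Fin n) : ‖Gj x a‖ₑ ≤ C * (N * L) *
      (ENNReal.ofReal ((ε ^ j)⁻¹) * maximal M₁ x + ENNReal.ofReal (ε ^ (m + 1)) * maximal M₂ x) := by
    refine le_of_tendsto ((continuous_enorm.tendsto _).comp (hx a)) (Eventually.of_forall fun i => ?_)
    set η := (shrinkingBump n i).normed volume
    have hη : ContDiff ℝ ∞ η := (shrinkingBump n i).contDiff_normed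
    have hηc : HasCompactSupport η := (shrinkingBump n i).hasCompactSupport_normed
    have hw := contDiff_convolution hη hηc hu
    have hlow : maximal (fun y => ‖(η ⋆[lsmul ℝ ℝ, volume] u) y‖ₑ) x ≤ N * L * maximal M₁ x := by
      rw [← maximal_const_mul hNL]
      refine maximal_mono_ae (ae_of_all _ fun y => ?_) x
      refine (enorm_convolution_shrinkingBump_le u i y).trans ?_
      have hN1 : 1 ≤ N := le_self_add
      exact mul_le_mul_left (le_mul_of_one_le_left (b := L) (by positivity) hN1) (M₁ y)
    have hhigh : maximal (fun y => ‖classicalGradient (j + (m + 1))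
        (η ⋆[lsmul ℝ ℝ, volume] u) y‖ₑ) x ≤ N * L * maximal M₂ x := by
      rw [← maximal_const_mul hNL]
      refine maximal_mono_ae (ae_of_all _ fun y => ?_) x
      refine (enorm_tensor_le_sum _).trans ?_
      calc ∑ b, ‖classicalGradient (j + (m + 1)) (η ⋆[lsmul ℝ ℝ, volume] u) y b‖ₑ
          ≤ ∑ _b : Fin (j + (m + 1)) → Fin n, L * M₂ y := by
            refine Finset.sum_le_sum fun b _ => ?_
            have e : classicalGradient (j + (m + 1)) (η ⋆[lsmul ℝ ℝ, volume] u) y b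
                = (η ⋆[lsmul ℝ ℝ, volume] fun y => Gk y b) y :=
              hGk.partialDeriv_convolution_eq hu hη hηc b y
            rw [e]
            refine (enorm_convolution_shrinkingBump_le _ i y).trans ?_
            gcongr
            exact maximal_mono_ae (ae_of_all _ fun z => enorm_apply_le_enorm (Gk z) b) y
        _ = Fintype.card (Fin (j + (m + 1)) → Fin n) * (L * M₂ y) := by
            rw [Finset.sum_const, Finset.card_univ, nsmul_eq_mul]
        _ ≤ N * L * M₂ y := by
            rw [mul_assoc N L]
            gcongr
            exact le_add_self
    rw [Function.comp_apply, ← hGj.partialDeriv_convolution_eq hu hη hηc a x]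
    refine (h _ hw a x ε hε).trans ?_
    rw [mul_assoc C, mul_add (N * L), mul_left_comm (N * L), mul_left_comm (N * L)]
    gcongr
  refine (enorm_tensor_le_sum _).trans ((Finset.sum_le_sum fun a _ => hcomp a).trans (le_of_eq ?_))
  rw [Finset.sum_const, Finset.card_univ, nsmul_eq_mul]
  ring

lemma IsWeakGradient.ae_eq_zero {m : ℕ} {u : Eucl n → ℝ} {G : Eucl n → Tensor n m}
    (hG : IsWeakGradient m u G) (hu : ∀ᵐ x, u x = 0) : ∀ᵐ x, G x = 0 := by
  have hcomp (a : Fin m → Fin n) : ∀ᵐ x, G x a = 0 := by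
    refine ae_eq_zero_of_integral_contDiff_smul_eq_zero
      (locallyIntegrable_apply hG.locallyIntegrable a) fun φ hφ hφc => ?_
    have h := hG.integral_eq φ hφ hφc a
    rw [integral_eq_zero_of_ae (by filter_upwards [hu] with x hx; simp [hx])] at h
    have h' := (mul_eq_zero.1 h.symm).resolve_left (pow_ne_zero m (by norm_num))
    simpa [mul_comm] using h'
  filter_upwards [ae_all_iff.2 hcomp] with x hx
  ext a
  simpa using hx a

end Mollification

/-! ### Choice of the scale and conversion of the exponents. -/

section Optimization

/-- The scale `ε = (B/A)^(1/k)`, with `k = j + m + 1`, makes both terms equal to `A^θ B^(1-θ)`. If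
`A = 0` let `ε → ∞`; if `B = 0` let `ε → 0`. -/
lemma le_two_mul_rpow_of_forall_scale {v C A B : ℝ≥0∞} (hC : C ≠ ⊤) (hA : A ≠ ⊤) (hB : B ≠ ⊤)
    {j m : ℕ} (hj : 1 ≤ j)
    (h : ∀ ε : ℝ, 0 < ε → v ≤ C * (ENNReal.ofReal ((ε ^ j)⁻¹) * B + ENNReal.ofReal (ε ^ (m + 1)) * A))
    {θ : ℝ} (hθ : θ = (j : ℝ) / (j + (m + 1) : ℕ)) :
    v ≤ 2 * C * (A ^ θ * B ^ (1 - θ)) := by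
  have hk : (0 : ℝ) < (j + (m + 1) : ℕ) := by positivity
  rcases eq_or_ne A 0 with rfl | hA0
  · have hlim : Tendsto (fun ε : ℝ => C * (ENNReal.ofReal ((ε ^ j)⁻¹) * B)) atTop (𝓝 0) := by
      have h1 : Tendsto (fun ε : ℝ => (ε ^ j)⁻¹) atTop (𝓝 0) :=
        (tendsto_pow_atTop (by omega)).inv_tendsto_atTop
      have h2 := ENNReal.Tendsto.const_mul (a := C)
        (ENNReal.Tendsto.mul_const (ENNReal.tendsto_ofReal h1) (Or.inr hB)) (Or.inr hC)
      simpa using h2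
    refine (ge_of_tendsto hlim ?_).trans bot_le
    filter_upwards [eventually_gt_atTop 0] with ε hε
    simpa using h ε hε
  rcases eq_or_ne B 0 with rfl | hB0
  · have hlim : Tendsto (fun ε : ℝ => C * (ENNReal.ofReal (ε ^ (m + 1)) * A)) (𝓝[>] 0) (𝓝 0) := by
      have h1 : Tendsto (fun ε : ℝ => ε ^ (m + 1)) (𝓝[>] 0) (𝓝 0) := by
        have : Tendsto (fun ε : ℝ => ε ^ (m + 1)) (𝓝 0) (𝓝 (0 ^ (m + 1))) :=
          (continuous_pow (m + 1)).tendsto 0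
        simpa using this.mono_left nhdsWithin_le_nhds
      have h2 := ENNReal.Tendsto.const_mul (a := C)
        (ENNReal.Tendsto.mul_const (ENNReal.tendsto_ofReal h1) (Or.inr hA)) (Or.inr hC)
      simpa using h2
    refine (ge_of_tendsto hlim ?_).trans bot_le
    filter_upwards [self_mem_nhdsWithin] with ε hε
    simpa using h ε hε
  obtain ⟨a, ha, rfl⟩ : ∃ a : ℝ, 0 < a ∧ ENNReal.ofReal a = A :=
    ⟨A.toReal, ENNReal.toReal_pos hA0 hA, ENNReal.ofReal_toReal hA⟩
  obtain ⟨b, hb, rfl⟩ : ∃ b : ℝ, 0 < b ∧ ENNReal.ofReal b = B :=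
    ⟨B.toReal, ENNReal.toReal_pos hB0 hB, ENNReal.ofReal_toReal hB⟩
  have hba : 0 < b / a := by positivity
  have hθ' : 1 - θ = ((m + 1 : ℕ) : ℝ) / (j + (m + 1) : ℕ) := by
    rw [hθ]
    field_simp
    push_cast
    ring
  set ε := (b / a) ^ ((1 : ℝ) / (j + (m + 1) : ℕ)) with hε
  have hε0 : 0 < ε := by positivity
  have e1 : (ε ^ j)⁻¹ * b = a ^ θ * b ^ (1 - θ) := by
    have : ε ^ j = (b / a) ^ θ := by
      rw [hε, ← Real.rpow_natCast, ← Real.rpow_mul hba.le, hθ, one_div_mul_eq_div]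
    rw [this, Real.div_rpow hb.le ha.le, Real.rpow_sub hb, Real.rpow_one]
    field_simp
  have e2 : ε ^ (m + 1) * a = a ^ θ * b ^ (1 - θ) := by
    have : ε ^ (m + 1) = (b / a) ^ (1 - θ) := by
      rw [hε, ← Real.rpow_natCast, ← Real.rpow_mul hba.le, hθ', one_div_mul_eq_div]
    rw [this, Real.div_rpow hb.le ha.le, Real.rpow_sub ha, Real.rpow_one]
    field_simp
  refine (h ε hε0).trans (le_of_eq ?_)
  rw [← ENNReal.ofReal_mul (by positivity), ← ENNReal.ofReal_mul (by positivity), e1, e2,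
    ENNReal.ofReal_rpow_of_pos ha, ENNReal.ofReal_rpow_of_pos hb,
    ← ENNReal.ofReal_mul (by positivity), ← two_mul, mul_comm (2 : ℝ≥0∞) C, mul_assoc]

lemma toReal_one_div_eq_of_eq {j k : ℕ} (hj : 1 ≤ j) (hjk : j < k) {P Q R : ℝ≥0∞} (hQ : Q ≠ 0)
    (hR : R ≠ 0)
    (h : 1 / P = ((j : ℝ≥0∞) / k) / R + (1 - (j : ℝ≥0∞) / k) / Q) :
    (1 / P).toReal
      = (j : ℝ) / k * (1 / R).toReal + (1 - (j : ℝ) / k) * (1 / Q).toReal := by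
  have hk : (k : ℝ≥0∞) ≠ 0 := by
    rw [Nat.cast_ne_zero]
    omega
  have hjk1 : (j : ℝ≥0∞) / k ≤ 1 := by
    refine ENNReal.div_le_of_le_mul ?_
    rw [one_mul]
    exact_mod_cast hjk.le
  have hjkt : (j : ℝ≥0∞) / k ≠ ⊤ := (hjk1.trans_lt ENNReal.one_lt_top).ne
  rw [h, ENNReal.toReal_add (ENNReal.div_ne_top hjkt hR)
    (ENNReal.div_ne_top (ENNReal.sub_ne_top ENNReal.one_ne_top) hQ)]
  simp only [ENNReal.toReal_div, ENNReal.toReal_sub_of_le hjk1 ENNReal.one_ne_top,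
    ENNReal.toReal_natCast, ENNReal.toReal_one]
  ring

end Optimization

end GagliardoNirenberg

/-- The last hypothesis only excludes that the right-hand side is the indeterminate product `0 · ∞`
(for instance, for non-zero polynomials of degree less than `k`). -/
theorem corollary1p3 (n j k : ℕ) (hj : 1 ≤ j) (hjk : j < k)
    (P Q R p q r : ℝ≥0∞) (hP : 1 < P) (hQ : 1 < Q) (hR : 1 < R)
    (hp : 1 ≤ p) (hq : 1 ≤ q) (hr : 1 ≤ r)
    (hPQR : 1 / P = ((j : ℝ≥0∞) / k) / R + (1 - (j : ℝ≥0∞) / k) / Q)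
    (hpqr : 1 / p = ((j : ℝ≥0∞) / k) / r + (1 - (j : ℝ≥0∞) / k) / q) :
    ∃ C : ℝ≥0, ∀ u : Eucl n → ℝ, WeaklyDifferentiable k u →
      ∀ (Gj : Eucl n → Tensor n j) (Gk : Eucl n → Tensor n k),
        IsWeakGradient j u Gj → IsWeakGradient k u Gk →
        ¬ (lorentzNorm Gk R r = 0 ∧ lorentzNorm u Q q = ⊤) →
        lorentzNorm Gj P p ≤
          C * lorentzNorm Gk R r ^ ((j : ℝ) / k) * lorentzNorm u Q q ^ (1 - (j : ℝ) / k) := by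
  have hPQR' := toReal_one_div_eq_of_eq hj hjk (zero_lt_one.trans hQ).ne'
    (zero_lt_one.trans hR).ne' hPQR
  have hpqr' := toReal_one_div_eq_of_eq hj hjk (zero_lt_one.trans_le hq).ne'
    (zero_lt_one.trans_le hr).ne' hpqr
  obtain ⟨m, rfl⟩ : ∃ m, k = j + (m + 1) := ⟨k - j - 1, by omega⟩
  set θ : ℝ := (j : ℝ) / (j + (m + 1) : ℕ) with hθ
  have hk : (0 : ℝ) < (j + (m + 1) : ℕ) := by positivity
  have h0 : 0 < θ := div_pos (by exact_mod_cast hj) hk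
  have h1 : θ < 1 := (div_lt_one hk).2 (by exact_mod_cast hjk)
  have h1' : 0 < 1 - θ := by linarith
  obtain ⟨C₀, hC₀, hpt⟩ := exists_weakGradient_le_maximal n j m
  obtain ⟨C₁, hC₁, hmaxR⟩ := exists_lorentz_maximal_maximal_le n hR hr
  obtain ⟨C₂, hC₂, hmaxQ⟩ := exists_lorentz_maximal_maximal_le n hQ hq
  set D : ℝ≥0∞ := 2 * C₀ * ENNReal.ofReal (2⁻¹ ^ (-(1 / P).toReal)) * (C₁ ^ θ * C₂ ^ (1 - θ))
    with hD
  have h2C₀ : 2 * C₀ ≠ ⊤ := ENNReal.mul_ne_top ENNReal.ofNat_ne_top hC₀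
  have hDt : D ≠ ⊤ := ENNReal.mul_ne_top (ENNReal.mul_ne_top h2C₀ ENNReal.ofReal_ne_top)
    (ENNReal.mul_ne_top (ENNReal.rpow_ne_top_of_nonneg h0.le hC₁)
      (ENNReal.rpow_ne_top_of_nonneg h1'.le hC₂))
  have hD1t : D + 1 ≠ ⊤ := ENNReal.add_ne_top.2 ⟨hDt, ENNReal.one_ne_top⟩
  -- `D` itself may vanish; a nonzero constant keeps the right-hand side infinite when one norm is
  -- infinite and the other is not zero.
  have hD10 : D + 1 ≠ 0 := by simp
  refine ⟨(D + 1).toNNReal, fun u hu Gj Gk hGj hGk hind => ?_⟩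
  rw [ENNReal.coe_toNNReal hD1t]
  simp only [lorentzNorm_eq_lorentz] at hind ⊢
  set NG := lorentz (fun x => ‖Gk x‖ₑ) R r with hNG
  set Nu := lorentz (fun x => ‖u x‖ₑ) Q q with hNu
  rcases eq_or_ne Nu 0 with hu0 | hu0
  -- Here the right-hand side is `0` even when the norm of `Gk` is infinite, because `0 * ⊤ = 0`;
  -- hence `Gj = 0` has to be proved outright.
  · have hae : ∀ᵐ x, u x = 0 := by
      simpa using ae_eq_zero_of_lorentz_eq_zero hq hu0
    have hGj0 := hGj.ae_eq_zero hae
    rw [lorentz_eq_zero_of_ae_eq_zero (by simpa using hGj0)]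
    exact bot_le
  rcases eq_or_ne Nu ⊤ with hut | hut
  · have hG0 : NG ≠ 0 := fun h => hind ⟨h, hut⟩
    have hpos : (D + 1) * NG ^ θ ≠ 0 :=
      mul_ne_zero hD10 (by simp [ENNReal.rpow_eq_zero_iff, hG0, not_lt.2 h0.le])
    rw [hut, ENNReal.top_rpow_of_pos h1', ENNReal.mul_top hpos]
    exact le_top
  rcases eq_or_ne NG ⊤ with hGt | hGt
  · have hpos : Nu ^ (1 - θ) ≠ 0 := by
      simp [ENNReal.rpow_eq_zero_iff, hu0, hut]
    rw [hGt, ENNReal.top_rpow_of_pos h0, ENNReal.mul_top hD10, ENNReal.top_mul hpos]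
    exact le_top
  set A := maximal (maximal fun y => ‖Gk y‖ₑ) with hA
  set B := maximal (maximal fun y => ‖u y‖ₑ) with hB
  have hAle : lorentz A R r ≤ C₁ * NG := hmaxR _ hGk.locallyIntegrable.aestronglyMeasurable.enorm
  have hBle : lorentz B Q q ≤ C₂ * Nu := hmaxQ _ hu.locallyIntegrable.aestronglyMeasurable.enorm
  have hAt : lorentz A R r ≠ ⊤ := ne_top_of_le_ne_top (ENNReal.mul_ne_top hC₁ hGt) hAle
  have hBt : lorentz B Q q ≠ ⊤ := ne_top_of_le_ne_top (ENNReal.mul_ne_top hC₂ hut) hBle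
  -- Optimizing the scale requires finite maximal functions, which the finite Lorentz norms supply
  -- almost everywhere.
  have hae : ∀ᵐ x, ‖Gj x‖ₑ ≤ 2 * C₀ * (A x ^ θ * B x ^ (1 - θ)) := by
    filter_upwards [hpt u hu.locallyIntegrable Gj Gk hGj hGk, ae_lt_top_of_lorentz_ne_top hr hAt,
      ae_lt_top_of_lorentz_ne_top hq hBt] with x hx hxA hxB
    exact le_two_mul_rpow_of_forall_scale hC₀ hxA.ne hxB.ne hj hx hθ
  calc lorentz (fun x => ‖Gj x‖ₑ) P p
      ≤ 2 * C₀ * ENNReal.ofReal (2⁻¹ ^ (-(1 / P).toReal)) *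
        (lorentz A R r ^ θ * lorentz B Q q ^ (1 - θ)) :=
        lorentz_le_of_ae_le_mul_rpow h2C₀ h0 h1 hp hq hr hPQR' hpqr' hae hAt hBt
    _ ≤ 2 * C₀ * ENNReal.ofReal (2⁻¹ ^ (-(1 / P).toReal)) *
        ((C₁ * NG) ^ θ * (C₂ * Nu) ^ (1 - θ)) := by gcongr
    _ = D * (NG ^ θ * Nu ^ (1 - θ)) := by
        rw [ENNReal.mul_rpow_of_nonneg _ _ h0.le, ENNReal.mul_rpow_of_nonneg _ _ h1'.le, hD]
        ring
    _ ≤ (D + 1) * NG ^ θ * Nu ^ (1 - θ) := by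
        rw [mul_assoc (D + 1)]
        gcongr
        exact le_self_add
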